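/- \textbf{Setup.} There are $N\ge 2$ arms; arm $i\in[N]$ has a reward distribution $\nu_i$ supported on $[0,1]$ with mean $\mu_i$ and variance $\sigma_i^2$. Let $\bar\sigma^2>0$ be a threshold, $\mathcal F=\{i:\sigma_i^2\le\bar\sigma^2\}$ the set of feasible arms and $\mathcal F^c$ its complement. The instance $(\nu,\bar\sigma^2)$ is feasible if $\mathcal F\neq\emptyset$; then $i^\star=\arg\max_{i\in\mathcal F}\mu_i$ is the best feasible arm, which is assumed to be unique and to satisfy $\sigma_{i^\star}^2<\bar\sigma^2$. (Every $\arg\max$ is the smallest maximizing index.) Let $\mathcal S=\{i:\mu_i<\mu_{i^\star}\}$ if the instance is feasible and $\mathcal S=\emptyset$ otherwise, and $\mathcal R=[N]\setminus\mathcal S$. The mean gaps are $\Delta_i=\mu_{i^\star}-\mu_i$ for $i\in\mathcal S$, and $\Delta_{i^\star}=\min_{i\in\mathcal S}\Delta_i$ ($=+\infty$ if $\mathcal S=\emptyset$); the variance gaps are $\Delta_i^{\mathrm v}=|\sigma_i^2-\bar\sigma^2|$. The hardness parameter is $$H_{\mathrm{VA}}=\frac1{\min\{\frac{\Delta_{i^\star}}2,\Delta^{\mathrm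 v}_{i^\star}\}^2}+\sum_{i\in\mathcal F\cap\mathcal S}\frac1{(\frac{\Delta_i}2)^2}+\sum_{i\in\mathcal F^c\cap\mathcal R}\frac1{(\Delta_i^{\mathrm v})^2}+\sum_{i\in\mathcal F^c\cap\mathcal S}\frac1{\max\{\frac{\Delta_i}2,\Delta_i^{\mathrm v}\}^2},$$ where the first term is absent if the instance is infeasible. If arm $i$ is pulled in round $r$, the reward $X_{r,i}\sim\nu_i$ is observed, where all $X_{r,i}$ ($r\in\mathbb N$, $i\in[N]$) are independent. \textbf{Algorithm VA-LUCB} (input $\bar\sigma^2$ and $\delta\in(0,1)$). Pull each arm twice (this counts as the time steps $1,\dots,N$) and set $\bar{\mathcal F}_N=[N]$. At each time step $t=N+1,N+2,\dots$, let $T_i(t)$, $\hat\mu_i(t)$, $\hat\sigma_i^2(t)$ be the number of pulls, the sample mean and the unbiased sample variance of arm $i$ so far, and put $\alpha_i(t)=\sqrt{\frac1{2T_i(t)}\ln\frac{2Nt^4}\delta}$, $L_i^\mu=\hat\mu_i-\alpha_i$, $U_i^\mu=\hat\mu_i+\alpha_i$, $L_i^{\mathrm v}=\hat\sigma_i^2-\alpha_i$,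 $U_i^{\mathrm v}=\hat\sigma_i^2+\alpha_i$. Let $\mathcal F_t=\{i\in\bar{\mathcal F}_{t-1}:U_i^{\mathrm v}(t)\le\bar\sigma^2\}$ and $\bar{\mathcal F}_t=\mathcal F_t\cup\{i\in\bar{\mathcal F}_{t-1}:L_i^{\mathrm v}(t)\le\bar\sigma^2<U_i^{\mathrm v}(t)\}$. If $\mathcal F_t\ne\emptyset$, let $i_t^\star=\arg\max_{i\in\mathcal F_t}\hat\mu_i(t)$ and $\mathcal P_t=\{i\ne i_t^\star:L^\mu_{i_t^\star}(t)\le U_i^\mu(t)\}$; otherwise let $\mathcal P_t=[N]$. If $\bar{\mathcal F}_t\ne\emptyset$, let $i_t=\arg\max_{i\in\bar{\mathcal F}_t}\hat\mu_i(t)$. If $\bar{\mathcal F}_t\cap\mathcal P_t=\emptyset$, terminate: output arm $i_t$ with flag $\hat{\mathsf f}=1$ if $\mathcal F_t\neq\emptyset$, and output the flag $\hat{\mathsf f}=0$ (infeasible) if $\mathcal F_t=\emptyset$. Otherwise, if $|\bar{\mathcal F}_t|=1$, pull $i_t$; if $|\bar{\mathcal F}_t|>1$, let $c_t=\arg\max_{i\in\bar{\mathcal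 F}_t\setminus\{i_t\}}U_i^\mu(t)$ and pull $i_t$ and then $c_t$ (in two rounds) if $U^\mu_{c_t}(t)\ge L^\mu_{i_t}(t)$, and only $i_t$ if not. \textbf{Theorem (Upper bound).} For every such instance $(\nu,\bar\sigma^2)$ and every $\delta\in(0,1)$, with probability at least $1-\delta$ VA-LUCB terminates and succeeds, that is, it outputs $\hat{\mathsf f}=0$ if the instance is infeasible, and $\hat{\mathsf f}=1$ together with the arm $i^\star$ if the instance is feasible, and the time step at which it terminates and the total number of rounds (arm pulls) are both at most $$304\,H_{\mathrm{VA}}\ln\frac{H_{\mathrm{VA}}}\delta .$$ -/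

import Mathlib

open MeasureTheory ProbabilityTheory

noncomputable section

namespace VALUCB

/-! ### Argmax with smallest-index tie-breaking -/

theorem argmax_aux {N : ℕ} (f : Fin N → ℝ) (S : Finset (Fin N)) (hS : S.Nonempty) :
    (S.filter (fun i => ∀ j ∈ S, f j ≤ f i)).Nonempty := by
  obtain ⟨i, hi, h⟩ := S.exists_max_image f hS
  exact ⟨i, Finset.mem_filter.mpr ⟨hi, h⟩⟩

/-- The smallest index in `S` at which `f` attains its maximum over `S`. -/
def argmax {N : ℕ} (f : Fin N → ℝ) (S : Finset (Fin N)) (hS : S.Nonempty) : Fin N :=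
  (S.filter (fun i => ∀ j ∈ S, f j ≤ f i)).min' (argmax_aux f S hS)

/-! ### Instances: `ν i` is the reward law of arm `i`, `v` is the variance threshold -/

/-- Expected reward of arm `i`. -/
def mean {N : ℕ} (ν : Fin N → Measure ℝ) (i : Fin N) : ℝ := ∫ x, x ∂(ν i)

/-- Variance of the reward of arm `i`. -/
def var {N : ℕ} (ν : Fin N → Measure ℝ) (i : Fin N) : ℝ := variance id (ν i)

/-- The set of feasible arms. -/
def feasible {N : ℕ} (ν : Fin N → Measure ℝ) (v : ℝ) : Finset (Fin N) :=
  Finset.univ.filter (fun i => var ν i ≤ v)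

/-- The best feasible arm of a feasible instance. -/
def bestArm {N : ℕ} (ν : Fin N → Measure ℝ) (v : ℝ) (hF : (feasible ν v).Nonempty) : Fin N :=
  argmax (mean ν) (feasible ν v) hF

/-- The set of suboptimal arms (empty for an infeasible instance). -/
def suboptimal {N : ℕ} (ν : Fin N → Measure ℝ) (v : ℝ) : Finset (Fin N) :=
  if hF : (feasible ν v).Nonempty then
    Finset.univ.filter (fun i => mean ν i < mean ν (bestArm ν v hF))
  else ∅

/-- The set of risky arms. -/
def risky {N : ℕ} (ν : Fin N → Measure ℝ) (v : ℝ) : Finset (Fin N) :=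
  (suboptimal ν v)ᶜ

/-- Mean gap of a suboptimal arm (used only for such arms; `0` for an infeasible instance). -/
def meanGap {N : ℕ} (ν : Fin N → Measure ℝ) (v : ℝ) (i : Fin N) : ℝ :=
  if hF : (feasible ν v).Nonempty then mean ν (bestArm ν v hF) - mean ν i else 0

/-- Variance gap of an arm. -/
def varGap {N : ℕ} (ν : Fin N → Measure ℝ) (v : ℝ) (i : Fin N) : ℝ := |var ν i - v|

/-- The quantity `min {Δ / 2, Δᵛ}` of the best feasible arm. Its mean gap `Δ` is that of the arm
of largest mean among the suboptimal arms, and is `+∞` if there is no suboptimal arm, in which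
case the minimum is the variance gap. -/
def bestGap {N : ℕ} (ν : Fin N → Measure ℝ) (v : ℝ) (hF : (feasible ν v).Nonempty) : ℝ :=
  if hS : (suboptimal ν v).Nonempty then
    min (meanGap ν v (argmax (mean ν) (suboptimal ν v) hS) / 2) (varGap ν v (bestArm ν v hF))
  else varGap ν v (bestArm ν v hF)

/-- The variance-aware hardness parameter. The first term is present only for feasible
instances. -/
def hardness {N : ℕ} (ν : Fin N → Measure ℝ) (v : ℝ) : ℝ :=
  (if hF : (feasible ν v).Nonempty then 1 / (bestGap ν v hF) ^ 2 else 0)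
    + ∑ i ∈ feasible ν v ∩ suboptimal ν v, 1 / (meanGap ν v i / 2) ^ 2
    + ∑ i ∈ (feasible ν v)ᶜ ∩ risky ν v, 1 / (varGap ν v i) ^ 2
    + ∑ i ∈ (feasible ν v)ᶜ ∩ suboptimal ν v, 1 / (max (meanGap ν v i / 2) (varGap ν v i)) ^ 2

/-- The correct answer: `none` (flag `0`) for an infeasible instance, and `some` of the best
feasible arm (flag `1`) for a feasible instance. -/
def correctAnswer {N : ℕ} (ν : Fin N → Measure ℝ) (v : ℝ) : Option (Fin N) :=
  if hF : (feasible ν v).Nonempty then some (bestArm ν v hF) else none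

/-! ### Empirical quantities of an observation history -/

/-- Observation history: the pulled arm and the observed reward of each round, oldest first. -/
abbrev History (N : ℕ) : Type := List (Fin N × ℝ)

/-- The rewards observed from arm `i`. -/
def samples {N : ℕ} (h : History N) (i : Fin N) : List ℝ :=
  (h.filter (fun p => p.1 = i)).map Prod.snd

/-- The number of pulls of arm `i`. -/
def pulls {N : ℕ} (h : History N) (i : Fin N) : ℕ := (samples h i).length

/-- Sample mean of arm `i`. -/
def sampleMean {N : ℕ} (h : History N) (i : Fin N) : ℝ :=
  (samples h i).sum / (pulls h i : ℝ)

/-- Unbiased sample variance of arm `i`. -/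
def sampleVar {N : ℕ} (h : History N) (i : Fin N) : ℝ :=
  ((samples h i).map (fun y => (y - sampleMean h i) ^ 2)).sum / ((pulls h i : ℝ) - 1)

/-- Confidence radius, for the mean and for the variance, at time step `t` after `T` pulls. -/
def radius (N : ℕ) (δ : ℝ) (t T : ℕ) : ℝ :=
  Real.sqrt (1 / (2 * (T : ℝ)) * Real.log (2 * (N : ℝ) * (t : ℝ) ^ 4 / δ))

/-- Lower confidence bound of the mean. -/
def lcbMean {N : ℕ} (δ : ℝ) (t : ℕ) (h : History N) (i : Fin N) : ℝ :=
  sampleMean h i - radius N δ t (pulls h i)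

/-- Upper confidence bound of the mean. -/
def ucbMean {N : ℕ} (δ : ℝ) (t : ℕ) (h : History N) (i : Fin N) : ℝ :=
  sampleMean h i + radius N δ t (pulls h i)

/-- Lower confidence bound of the variance. -/
def lcbVar {N : ℕ} (δ : ℝ) (t : ℕ) (h : History N) (i : Fin N) : ℝ :=
  sampleVar h i - radius N δ t (pulls h i)

/-- Upper confidence bound of the variance. -/
def ucbVar {N : ℕ} (δ : ℝ) (t : ℕ) (h : History N) (i : Fin N) : ℝ :=
  sampleVar h i + radius N δ t (pulls h i)

/-! ### The sets computed at time step `t`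

`A` is the possibly feasible set of the previous time step: confidence bounds are updated only
for arms in `A`, so an arm that was once declared infeasible stays so. -/

/-- Empirically feasible set. -/
def empFeasible {N : ℕ} (v δ : ℝ) (t : ℕ) (A : Finset (Fin N)) (h : History N) :
    Finset (Fin N) :=
  A.filter (fun i => ucbVar δ t h i ≤ v)

/-- Empirically almost feasible set. -/
def empAlmostFeasible {N : ℕ} (v δ : ℝ) (t : ℕ) (A : Finset (Fin N)) (h : History N) :
    Finset (Fin N) :=
  A.filter (fun i => lcbVar δ t h i ≤ v ∧ v < ucbVar δ t h i)

/-- Possibly feasible set. -/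
def possFeasible {N : ℕ} (v δ : ℝ) (t : ℕ) (A : Finset (Fin N)) (h : History N) :
    Finset (Fin N) :=
  empFeasible v δ t A h ∪ empAlmostFeasible v δ t A h

/-- Potential set. -/
def potential {N : ℕ} (v δ : ℝ) (t : ℕ) (A : Finset (Fin N)) (h : History N) :
    Finset (Fin N) :=
  if hF : (empFeasible v δ t A h).Nonempty then
    Finset.univ.filter (fun i =>
      lcbMean δ t h (argmax (sampleMean h) (empFeasible v δ t A h) hF) ≤ ucbMean δ t h i ∧
        i ≠ argmax (sampleMean h) (empFeasible v δ t A h) hF)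
  else Finset.univ

/-! ### The algorithm -/

/-- What is done at a time step: halt, with flag `0` (`none`) or with flag `1` and an arm
(`some`), or pull one arm, or pull two arms in two rounds. -/
inductive Action (N : ℕ) : Type
  | halt (answer : Option (Fin N)) : Action N
  | pullOne (i : Fin N) : Action N
  | pullTwo (i c : Fin N) : Action N

/-- The decision of VA-LUCB at time step `t`. -/
def action {N : ℕ} (v δ : ℝ) (t : ℕ) (A : Finset (Fin N)) (h : History N) : Action N :=
  if hP : possFeasible v δ t A h ∩ potential v δ t A h = ∅ then
    if hF : (empFeasible v δ t A h).Nonempty then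
      Action.halt (some (argmax (sampleMean h) (possFeasible v δ t A h)
        (hF.mono Finset.subset_union_left)))
    else Action.halt none
  else
    let i : Fin N := argmax (sampleMean h) (possFeasible v δ t A h)
      ((Finset.nonempty_iff_ne_empty.mpr hP).mono Finset.inter_subset_left)
    -- the next test says that the possibly feasible set has more than one element
    if hc : ((possFeasible v δ t A h).erase i).Nonempty then
      let c : Fin N := argmax (ucbMean δ t h) ((possFeasible v δ t A h).erase i) hc
      if lcbMean δ t h i ≤ ucbMean δ t h c then Action.pullTwo i c else Action.pullOne i
    else Action.pullOne i

/-- Pull arm `i` in the next round. Rounds are numbered from `0`, and `x r i` is the reward that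
arm `i` yields if it is pulled in round `r`. -/
def pull {N : ℕ} (x : ℕ → Fin N → ℝ) (h : History N) (i : Fin N) : History N :=
  h ++ [(i, x h.length i)]

/-- Configurations of the algorithm: still running, with the current possibly feasible set and
the history, or stopped at time step `τ` with the final history and the answer. -/
inductive Config (N : ℕ) : Type
  | running (A : Finset (Fin N)) (h : History N) : Config N
  | stopped (τ : ℕ) (h : History N) (answer : Option (Fin N)) : Config N

/-- Execution of time step `t`. -/
def step {N : ℕ} (v δ : ℝ) (x : ℕ → Fin N → ℝ) (t : ℕ) : Config N → Config N
  | Config.stopped τ h answer => Config.stopped τ h answer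
  | Config.running A h =>
    match action v δ t A h with
    | Action.halt answer => Config.stopped t h answer
    | Action.pullOne i => Config.running (possFeasible v δ t A h) (pull x h i)
    | Action.pullTwo i c => Config.running (possFeasible v δ t A h) (pull x (pull x h i) c)

/-- The history after the warm-up, in which each arm is pulled twice. -/
def warmUp {N : ℕ} (x : ℕ → Fin N → ℝ) : History N :=
  (List.finRange N ++ List.finRange N).foldl (pull x) []

/-- The configuration after the warm-up, which counts as the time steps `1, …, N`, and the `k`
further time steps `N + 1, …, N + k`. -/
def config {N : ℕ} (v δ : ℝ) (x : ℕ → Fin N → ℝ) : ℕ → Config N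
  | 0 => Config.running Finset.univ (warmUp x)
  | k + 1 => step v δ x (N + 1 + k) (config v δ x k)

/-- On the reward table `x`, VA-LUCB terminates at time step `τ` with history `h` and the given
answer. The number of rounds played is `h.length`. -/
def TerminatesWith {N : ℕ} (v δ : ℝ) (x : ℕ → Fin N → ℝ) (τ : ℕ) (h : History N)
    (answer : Option (Fin N)) : Prop :=
  ∃ k : ℕ, config v δ x k = Config.stopped τ h answer

end VALUCB

end

/-! The proof separates probability from a pathwise analysis: on the event `Accurate`, where every
confidence interval in use is correct, the run is treated deterministically, and the complement has
probability at most `δ`.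

Probability. For a fixed number of pulls, the sample mean obeys Hoeffding's inequality, and so does
the unbiased sample variance, being an average over permutations of means over disjoint pairs
(`sampleVar_tail`). The samples are however collected adaptively. Optional skipping
(`measure_config_le`) transfers the bounds: the next reward comes from an unread row of the table,
independent of the past, so an adaptive sample of given length violates its bounds no more often
than a fixed column does. A union bound yields `measure_not_accurate_le`.

Analysis. With correct intervals the best feasible arm is never discarded and a halt gives the
correct answer (`AccurateAt.answer_eq`). A step that does not halt pulls some arm whose `gap` is at
most twice its radius (`AccurateAt.gap_le_of_pullOne`, `AccurateAt.gap_le_of_pullTwo`), hence an arm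
with at most `2 Λ / gap ^ 2` pulls so far, `Λ` being the logarithm in the radius. Inverse squared
gaps sum to the hardness `H`, so the number of time steps is at most `2 Λ H`; as `Λ` involves that
number, the inequality is solved in `le_of_le_mul_log`. -/

noncomputable section

namespace VALUCB

/-! ### Independence of functions of disjoint groups of coordinates -/

/-- The σ-algebra generated by the random variables `ξ i`, `i ∈ S`. -/
abbrev sigmaOf {Ω ι : Type*} (ξ : ι → Ω → ℝ) (S : Set ι) : MeasurableSpace Ω :=
  ⨆ i ∈ S, MeasurableSpace.comap (ξ i) inferInstance

theorem measurable_sigmaOf {Ω ι : Type*} (ξ : ι → Ω → ℝ) {S : Set ι} {i : ι} (hi : i ∈ S) :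
    Measurable[sigmaOf ξ S] (ξ i) :=
  (comap_measurable (ξ i)).mono (le_iSup₂_of_le i hi le_rfl) le_rfl

/-- Stated for generated σ-algebras so as to serve both finite blocks of rewards and the whole
remainder of the reward table. -/
theorem indepFun_of_disjoint {Ω ι β γ : Type*} [MeasurableSpace Ω] [MeasurableSpace β]
    [MeasurableSpace γ] {μ : Measure Ω} {ξ : ι → Ω → ℝ} (hξ : ∀ i, Measurable (ξ i))
    (hind : iIndepFun ξ μ) {S T : Set ι} (hST : Disjoint S T) {f : Ω → β} {g : Ω → γ}
    (hf : Measurable[sigmaOf ξ S] f) (hg : Measurable[sigmaOf ξ T] g) : IndepFun f g μ := by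
  rw [IndepFun_iff_Indep]
  have h := indep_iSup_of_disjoint (fun i => (hξ i).comap_le) hind.iIndep hST
  exact indep_of_indep_of_le_left (indep_of_indep_of_le_right h hg.comap_le) hf.comap_le

/-! ### Sub-Gaussian tails -/

theorem HasSubgaussianMGF.abs_tail {Ω : Type*} [MeasurableSpace Ω] {μ : Measure Ω}
    [IsProbabilityMeasure μ] {Y : Ω → ℝ} {c : NNReal} (h : HasSubgaussianMGF Y c μ) {ρ : ℝ}
    (hρ : 0 ≤ ρ) : μ.real {ω | ρ < |Y ω|} ≤ 2 * Real.exp (-ρ ^ 2 / (2 * c)) := by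
  have h1 := h.measure_ge_le hρ
  have h2 := h.neg.measure_ge_le hρ
  have hsub : {ω | ρ < |Y ω|} ⊆ {ω | ρ ≤ Y ω} ∪ {ω | ρ ≤ (-Y) ω} := by
    intro ω hω
    rcases lt_abs.1 (show ρ < |Y ω| from hω) with h | h
    · exact Or.inl h.le
    · exact Or.inr h.le
  calc μ.real {ω | ρ < |Y ω|} ≤ μ.real ({ω | ρ ≤ Y ω} ∪ {ω | ρ ≤ (-Y) ω}) :=
        measureReal_mono hsub
    _ ≤ _ := measureReal_union_le _ _
    _ ≤ _ := by linarith

/-- An average of sub-Gaussian random variables, not necessarily independent, is sub-Gaussian with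
the same parameter. -/
theorem HasSubgaussianMGF.average {Ω κ : Type*} [MeasurableSpace Ω] {μ : Measure Ω} [Fintype κ]
    [Nonempty κ] {Y : κ → Ω → ℝ} {c : NNReal} (h : ∀ a, HasSubgaussianMGF (Y a) c μ) :
    HasSubgaussianMGF (fun ω => ∑ a, (Fintype.card κ : ℝ)⁻¹ * Y a ω) c μ := by
  have hcard : (0 : ℝ) < Fintype.card κ := by exact_mod_cast Fintype.card_pos
  have hw : ∑ _a : κ, (Fintype.card κ : ℝ)⁻¹ = 1 := by
    rw [Finset.sum_const, nsmul_eq_mul, Finset.card_univ, mul_inv_cancel₀ hcard.ne']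
  -- Jensen's inequality for the exponential: the moment generating function of an average is at
  -- most the average of the moment generating functions, whatever the dependence.
  have hle : ∀ t ω, Real.exp (t * ∑ a, (Fintype.card κ : ℝ)⁻¹ * Y a ω) ≤
      ∑ a, (Fintype.card κ : ℝ)⁻¹ * Real.exp (t * Y a ω) := by
    intro t ω
    have := convexOn_exp.map_sum_le (t := Finset.univ) (w := fun _ : κ => (Fintype.card κ : ℝ)⁻¹)
      (p := fun a => t * Y a ω) (fun _ _ => by positivity) hw (fun _ _ => Set.mem_univ _)
    simp only [smul_eq_mul] at this
    refine le_trans (le_of_eq ?_) this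
    congr 1
    rw [Finset.mul_sum]
    exact Finset.sum_congr rfl fun _ _ => by ring
  have hint : ∀ t, Integrable
      (fun ω => ∑ a, (Fintype.card κ : ℝ)⁻¹ * Real.exp (t * Y a ω)) μ := fun t =>
    integrable_finsetSum _ fun a _ => ((h a).integrable_exp_mul t).const_mul _
  have hmeas : AEMeasurable (fun ω => ∑ a, (Fintype.card κ : ℝ)⁻¹ * Y a ω) μ :=
    Finset.aemeasurable_fun_sum _ fun a _ => (h a).aemeasurable.const_mul _
  have hint' : ∀ t, Integrable
      (fun ω => Real.exp (t * ∑ a, (Fintype.card κ : ℝ)⁻¹ * Y a ω)) μ := by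
    intro t
    refine (hint t).mono' (Real.measurable_exp.comp_aemeasurable
      (hmeas.const_mul t)).aestronglyMeasurable (ae_of_all _ fun ω => ?_)
    rw [Real.norm_eq_abs, abs_of_pos (Real.exp_pos _)]
    exact hle t ω
  refine ⟨hint', fun t => ?_⟩
  calc mgf (fun ω => ∑ a, (Fintype.card κ : ℝ)⁻¹ * Y a ω) μ t
      ≤ ∫ ω, ∑ a, (Fintype.card κ : ℝ)⁻¹ * Real.exp (t * Y a ω) ∂μ :=
        integral_mono (hint' t) (hint t) (hle t)
    _ = ∑ a, (Fintype.card κ : ℝ)⁻¹ * mgf (Y a) μ t := by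
        rw [integral_finsetSum _ fun a _ => ((h a).integrable_exp_mul t).const_mul _]
        exact Finset.sum_congr rfl fun a _ => integral_const_mul _ _
    _ ≤ ∑ _a : κ, (Fintype.card κ : ℝ)⁻¹ * Real.exp (c * t ^ 2 / 2) :=
        Finset.sum_le_sum fun a _ => mul_le_mul_of_nonneg_left ((h a).mgf_le t) (by positivity)
    _ = Real.exp (c * t ^ 2 / 2) := by rw [← Finset.sum_mul, hw, one_mul]

/-! ### Concentration of the sample mean -/

section Concentration

variable {Ω : Type*} [MeasurableSpace Ω] {μ : Measure Ω} [IsProbabilityMeasure μ]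
  {n : ℕ} {ξ : Fin n → Ω → ℝ}

theorem sum_div_tail (hξ : ∀ i, Measurable (ξ i)) (hind : iIndepFun ξ μ)
    (hb : ∀ i, ∀ᵐ ω ∂μ, ξ i ω ∈ Set.Icc (0 : ℝ) 1) {m : ℝ} (hm : ∀ i, ∫ ω, ξ i ω ∂μ = m)
    (hn : 1 ≤ n) {ρ : ℝ} (hρ : 0 ≤ ρ) :
    μ.real {ω | ρ < |(∑ i, ξ i ω) / n - m|} ≤ 2 * Real.exp (-(2 * n * ρ ^ 2)) := by
  have hn0 : (0 : ℝ) < n := by exact_mod_cast hn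
  -- Each summand lies in `[0, 1/n]`, so Hoeffding's lemma gives the parameter `(1/(2n))²`; the `n`
  -- parameters add up to `1/(4n)`.
  have hsub : ∀ i, HasSubgaussianMGF (fun ω => ξ i ω / n - ∫ ω, ξ i ω / n ∂μ)
      ((‖1 / (n : ℝ) - 0‖₊ / 2) ^ 2) μ := fun i => by
    refine hasSubgaussianMGF_of_mem_Icc ((hξ i).div_const _).aemeasurable ?_
    filter_upwards [hb i] with ω hω
    exact ⟨div_nonneg hω.1 hn0.le, div_le_div_of_nonneg_right hω.2 hn0.le⟩
  have hind' : iIndepFun (fun i ω => ξ i ω / n - ∫ ω, ξ i ω / n ∂μ) μ :=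
    hind.comp (fun i y => y / n - ∫ ω, ξ i ω / n ∂μ) fun i => by fun_prop
  have hs := HasSubgaussianMGF.sum_of_iIndepFun hind' (s := Finset.univ) (fun i _ => hsub i)
  have h := HasSubgaussianMGF.abs_tail hs hρ
  have e1 : ∀ ω, ∑ i, (ξ i ω / n - ∫ ω, ξ i ω / n ∂μ) = (∑ i, ξ i ω) / n - m := by
    intro ω
    rw [Finset.sum_sub_distrib, ← Finset.sum_div]
    simp only [integral_div, hm, Finset.sum_const, Finset.card_univ, Fintype.card_fin,
      nsmul_eq_mul]
    field_simp
  simp only [e1] at h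
  refine h.trans (le_of_eq ?_)
  congr 2
  push_cast
  simp only [sub_zero, Finset.sum_const, Finset.card_univ, Fintype.card_fin, nsmul_eq_mul,
    Real.norm_eq_abs, abs_of_pos (div_pos one_pos hn0)]
  field_simp

/-! ### Concentration of the unbiased sample variance -/

/-- Right multiplication by a permutation carrying `(a, b)` to `(i, j)` reindexes the sum over `π`,
so all pairs of distinct positions contribute equally and the mean over `π` is the mean over ordered
pairs. -/
theorem sum_perm_pairs {n : ℕ} (f : Fin n → Fin n → ℝ) (hf : ∀ i, f i i = 0) {a b : Fin n}
    (hab : a ≠ b) : (n * (n - 1) : ℝ) * ∑ π : Equiv.Perm (Fin n), f (π a) (π b) =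
      (n.factorial : ℝ) * ∑ i, ∑ j, f i j := by
  set Q : Fin n → Fin n → ℝ := fun i j => ∑ π : Equiv.Perm (Fin n), f (π i) (π j)
  have hQ : ∀ i j, i ≠ j → Q i j = Q a b := by
    intro i j hij
    obtain ⟨σ, hσa, hσb⟩ : ∃ σ : Equiv.Perm (Fin n), σ a = i ∧ σ b = j := by
      -- Send `a` to `i` first, then move the image of `b` to `j`; the second swap fixes `i`.
      refine ⟨Equiv.swap (Equiv.swap a i b) j * Equiv.swap a i, ?_, by simp⟩
      rw [Equiv.Perm.mul_apply, Equiv.swap_apply_left]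
      refine Equiv.swap_apply_of_ne_of_ne ?_ hij
      intro h
      have := (Equiv.swap a i).injective ((Equiv.swap_apply_left a i).trans h)
      exact hab this
    rw [← hσa, ← hσb]
    exact Fintype.sum_equiv (Equiv.mulRight σ) _ _ fun π => rfl
  have h1 : ∑ i, ∑ j, Q i j = (n.factorial : ℝ) * ∑ i, ∑ j, f i j := by
    calc ∑ i, ∑ j, Q i j = ∑ i, ∑ π : Equiv.Perm (Fin n), ∑ j, f (π i) (π j) :=
          Finset.sum_congr rfl fun i _ => Finset.sum_comm
      _ = ∑ π : Equiv.Perm (Fin n), ∑ i, ∑ j, f (π i) (π j) := Finset.sum_comm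
      _ = ∑ _π : Equiv.Perm (Fin n), ∑ i, ∑ j, f i j := by
          refine Finset.sum_congr rfl fun π _ => ?_
          rw [← Equiv.sum_comp π fun i => ∑ j, f i j]
          exact Finset.sum_congr rfl fun i _ => Equiv.sum_comp π fun j => f (π i) j
      _ = _ := by
          rw [Finset.sum_const, Finset.card_univ, Fintype.card_perm, Fintype.card_fin,
            nsmul_eq_mul]
  have h2 : ∑ i, ∑ j, Q i j = (n * (n - 1) : ℝ) * Q a b := by
    have : ∀ i, ∑ j, Q i j = (n - 1 : ℝ) * Q a b := by
      intro i
      rw [← Finset.add_sum_erase _ _ (Finset.mem_univ i)]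
      have h0 : Q i i = 0 := Finset.sum_eq_zero fun π _ => hf _
      rw [h0, zero_add, Finset.sum_congr rfl fun j hj => hQ i j (Finset.ne_of_mem_erase hj).symm,
        Finset.sum_const, Finset.card_erase_of_mem (Finset.mem_univ _), Finset.card_univ,
        Fintype.card_fin, nsmul_eq_mul, Nat.cast_sub (by have := i.2; omega), Nat.cast_one]
    rw [Finset.sum_congr rfl fun i _ => this i, Finset.sum_const, Finset.card_univ,
      Fintype.card_fin, nsmul_eq_mul]
    ring
  exact h2.symm.trans h1

/-- This exhibits the sample variance as a U-statistic with kernel `(y - z)² / 2`. -/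
theorem sum_sub_mean_sq {n : ℕ} (hn : 1 ≤ n) (y : Fin n → ℝ) :
    ∑ i, ∑ j, (y i - y j) ^ 2 = 2 * n * ∑ i, (y i - (∑ j, y j) / n) ^ 2 := by
  have hn0 : (n : ℝ) ≠ 0 := by exact_mod_cast (by omega : n ≠ 0)
  have h1 : ∀ i, ∑ j, (y i - y j) ^ 2 = n * y i ^ 2 - 2 * y i * ∑ j, y j + ∑ j, y j ^ 2 := by
    intro i
    have : ∀ j, (y i - y j) ^ 2 = y i ^ 2 - 2 * y i * y j + y j ^ 2 := fun j => by ring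
    simp only [this, Finset.sum_add_distrib, Finset.sum_sub_distrib, ← Finset.mul_sum,
      Finset.sum_const, Finset.card_univ, Fintype.card_fin, nsmul_eq_mul]
  have h2 : ∀ i, (y i - (∑ j, y j) / n) ^ 2 =
      y i ^ 2 - 2 * ((∑ j, y j) / n) * y i + ((∑ j, y j) / n) ^ 2 := fun i => by ring
  simp only [h1, h2, Finset.sum_add_distrib, Finset.sum_sub_distrib, ← Finset.mul_sum,
    ← Finset.sum_mul, Finset.sum_const, Finset.card_univ, Fintype.card_fin, nsmul_eq_mul]
  field_simp
  ring

/-- Block averages of squared differences over disjoint pairs of coordinates are sub-Gaussian. -/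
theorem hasSubgaussianMGF_pairs (hξ : ∀ i, Measurable (ξ i)) (hind : iIndepFun ξ μ)
    (hb : ∀ i, ∀ᵐ ω ∂μ, ξ i ω ∈ Set.Icc (0 : ℝ) 1) {w : ℝ} (hw : 0 ≤ w) {s2 : ℝ}
    (hs2 : ∀ i j, i ≠ j → ∫ ω, w * (ξ i ω - ξ j ω) ^ 2 ∂μ = s2)
    (a : ℕ → Fin n) {k : ℕ} (ha : ∀ i j, i < 2 * k → j < 2 * k → a i = a j → i = j) :
    HasSubgaussianMGF (fun ω => ∑ l ∈ Finset.range k,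
      (w * (ξ (a (2 * l)) ω - ξ (a (2 * l + 1)) ω) ^ 2 - s2))
      (k * (‖w - 0‖₊ / 2) ^ 2) μ := by
  have hterm : ∀ l < k, HasSubgaussianMGF
      (fun ω => w * (ξ (a (2 * l)) ω - ξ (a (2 * l + 1)) ω) ^ 2 - s2) ((‖w - 0‖₊ / 2) ^ 2) μ := by
    intro l hl
    rw [← hs2 (a (2 * l)) (a (2 * l + 1)) fun h => by
      have := ha _ _ (by omega) (by omega) h
      omega]
    refine hasSubgaussianMGF_of_mem_Icc
      (((hξ _).sub (hξ _)).pow_const 2 |>.const_mul w).aemeasurable ?_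
    filter_upwards [hb (a (2 * l)), hb (a (2 * l + 1))] with ω h1 h2
    refine ⟨by positivity, mul_le_of_le_one_right hw ?_⟩
    have := h1.1; have := h1.2; have := h2.1; have := h2.2
    rw [sq_le_one_iff_abs_le_one, abs_le]
    constructor <;> linarith
  suffices H : ∀ m ≤ k, HasSubgaussianMGF (fun ω => ∑ l ∈ Finset.range m,
      (w * (ξ (a (2 * l)) ω - ξ (a (2 * l + 1)) ω) ^ 2 - s2)) (m * (‖w - 0‖₊ / 2) ^ 2) μ from
    H k le_rfl
  intro m
  induction m with
  | zero => intro _; simp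
  | succ m ih =>
    intro hm
    have h := HasSubgaussianMGF.add_of_indepFun (ih (by omega)) (hterm m (by omega)) ?_
    · simp only [Finset.sum_range_succ, Nat.cast_succ, add_mul, one_mul]
      exact h
    · refine indepFun_of_disjoint hξ hind (S := {i | ∃ j < 2 * m, a j = i})
        (T := {a (2 * m), a (2 * m + 1)}) ?_ ?_ ?_
      · rw [Set.disjoint_left]
        rintro i ⟨j, hj, rfl⟩ (h | h)
        · have := ha _ _ (by omega) (by omega) h
          omega
        · have := ha _ _ (by omega) (by omega) h
          omega
      · refine Finset.measurable_sum _ fun l hl => ?_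
        have hl := Finset.mem_range.1 hl
        have hmem : ∀ j < 2 * m, a j ∈ {i | ∃ j < 2 * m, a j = i} := fun j hj => ⟨j, hj, rfl⟩
        exact (((measurable_sigmaOf ξ (hmem (2 * l) (by omega))).sub
          (measurable_sigmaOf ξ (hmem (2 * l + 1) (by omega)))).pow_const 2 |>.const_mul w).sub_const _
      · exact (((measurable_sigmaOf ξ (by simp)).sub
          (measurable_sigmaOf ξ (by simp))).pow_const 2 |>.const_mul w).sub_const _

/-- Hoeffding's device for U-statistics: the sample variance is the average over permutations of the
mean of `(ξ - ξ')² / 2` over `⌊n/2⌋` disjoint pairs. Each such mean is a sum of independent bounded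
terms, and averaging keeps its parameter. The kernel has range `1/2`, which makes up for the smaller
number of terms, so the tail is that of the sample mean. -/
theorem sampleVar_tail (hξ : ∀ i, Measurable (ξ i)) (hind : iIndepFun ξ μ)
    (hb : ∀ i, ∀ᵐ ω ∂μ, ξ i ω ∈ Set.Icc (0 : ℝ) 1) {s2 : ℝ}
    (hs2 : ∀ i j, i ≠ j → ∫ ω, (ξ i ω - ξ j ω) ^ 2 ∂μ = 2 * s2)
    (hn : 2 ≤ n) {ρ : ℝ} (hρ : 0 ≤ ρ) :
    μ.real {ω | ρ < |(∑ i, (ξ i ω - (∑ j, ξ j ω) / n) ^ 2) / (n - 1) - s2|} ≤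
      2 * Real.exp (-(2 * n * ρ ^ 2)) := by
  have hn1 : (0 : ℝ) < n - 1 := by
    have : (2 : ℝ) ≤ n := by exact_mod_cast hn
    linarith
  have hn0 : (0 : ℝ) < n := by linarith
  set k := n / 2 with hk
  have hk1 : 1 ≤ k := by omega
  -- With `k` pairs the exponent is `-8kρ²`.
  have hkn : n ≤ 4 * k := by omega
  have hk0 : (0 : ℝ) < k := by exact_mod_cast hk1
  set a : ℕ → Fin n := fun i => ⟨i % n, Nat.mod_lt _ (by omega)⟩ with ha
  have hainj : ∀ i j, i < 2 * k → j < 2 * k → a i = a j → i = j := by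
    intro i j hi hj h
    have := congrArg Fin.val h
    simpa [ha, Nat.mod_eq_of_lt (show i < n by omega), Nat.mod_eq_of_lt (show j < n by omega)]
      using this
  have hpair : ∀ π : Equiv.Perm (Fin n), HasSubgaussianMGF (fun ω => ∑ l ∈ Finset.range k,
      (1 / (2 * k : ℝ) * (ξ (π (a (2 * l))) ω - ξ (π (a (2 * l + 1))) ω) ^ 2 - s2 / k))
      (k * (‖1 / (2 * k : ℝ) - 0‖₊ / 2) ^ 2) μ := by
    intro π
    refine hasSubgaussianMGF_pairs hξ hind hb (by positivity) ?_ (fun i => π (a i))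
      fun i j hi hj h => hainj i j hi hj (π.injective h)
    intro i j hij
    rw [integral_const_mul, hs2 i j hij]
    field_simp
  have havg := HasSubgaussianMGF.average hpair
  have hval : ∀ ω, ∑ π : Equiv.Perm (Fin n), (Fintype.card (Equiv.Perm (Fin n)) : ℝ)⁻¹ *
      ∑ l ∈ Finset.range k,
        (1 / (2 * k : ℝ) * (ξ (π (a (2 * l))) ω - ξ (π (a (2 * l + 1))) ω) ^ 2 - s2 / k) =
      (∑ i, (ξ i ω - (∑ j, ξ j ω) / n) ^ 2) / (n - 1) - s2 := by
    intro ω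
    set V := (∑ i, (ξ i ω - (∑ j, ξ j ω) / n) ^ 2) / (n - 1) with hV
    have hfac : (0 : ℝ) < n.factorial := by exact_mod_cast Nat.factorial_pos n
    have hS : ∀ l ∈ Finset.range k, ∑ π : Equiv.Perm (Fin n),
        (1 / (2 * k : ℝ) * (ξ (π (a (2 * l))) ω - ξ (π (a (2 * l + 1))) ω) ^ 2 - s2 / k) =
        n.factorial * (V / k - s2 / k) := by
      intro l hl
      have hl := Finset.mem_range.1 hl
      have h1 := sum_perm_pairs (fun i j => (ξ i ω - ξ j ω) ^ 2) (fun i => by simp)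
        (a := a (2 * l)) (b := a (2 * l + 1)) (fun h => by
          have := hainj _ _ (by omega) (by omega) h
          omega)
      rw [sum_sub_mean_sq (by omega) fun i => ξ i ω] at h1
      have h2 : ∑ π : Equiv.Perm (Fin n), (ξ (π (a (2 * l))) ω - ξ (π (a (2 * l + 1))) ω) ^ 2 =
          n.factorial * (2 * V) := by
        rw [hV]
        generalize ∑ i, (ξ i ω - (∑ j, ξ j ω) / n) ^ 2 = W at h1 ⊢
        field_simp
        field_simp at h1
        linear_combination h1
      rw [Finset.sum_sub_distrib, ← Finset.mul_sum, h2, Finset.sum_const, Finset.card_univ,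
        Fintype.card_perm, Fintype.card_fin, nsmul_eq_mul]
      field_simp
    rw [← Finset.mul_sum, Finset.sum_comm, Finset.sum_congr rfl hS, Finset.sum_const,
      Finset.card_range, Fintype.card_perm, Fintype.card_fin, nsmul_eq_mul]
    field_simp
  have h := HasSubgaussianMGF.abs_tail havg hρ
  simp only [hval] at h
  refine h.trans ?_
  gcongr
  push_cast
  have e : (2 * ((k : ℝ) * (‖1 / (2 * k : ℝ) - 0‖ / 2) ^ 2)) = 1 / (8 * k) := by
    rw [sub_zero, Real.norm_eq_abs, abs_of_pos (by positivity)]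
    field_simp
    norm_num
  rw [e]
  have : (n : ℝ) ≤ 4 * k := by exact_mod_cast hkn
  have h3 : (n : ℝ) * ρ ^ 2 ≤ 4 * k * ρ ^ 2 := mul_le_mul_of_nonneg_right this (sq_nonneg _)
  rw [div_div_eq_mul_div, div_one]
  linarith

theorem integral_sq_sub_of_iid {Ω : Type*} [MeasurableSpace Ω] {μ : Measure Ω}
    [IsProbabilityMeasure μ] {Y Z : Ω → ℝ} (hY : Measurable Y) (hZ : Measurable Z)
    (hind : IndepFun Y Z μ) {ν : Measure ℝ} [IsProbabilityMeasure ν] (hYν : μ.map Y = ν)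
    (hZν : μ.map Z = ν) (hsupp : ∀ᵐ y ∂ν, y ∈ Set.Icc (0 : ℝ) 1) :
    ∫ ω, (Y ω - Z ω) ^ 2 ∂μ = 2 * variance id ν := by
  have hid : MemLp (id : ℝ → ℝ) 2 ν := memLp_of_bounded hsupp (by fun_prop) 2
  have hYL : MemLp Y 2 μ := by
    rw [← hYν] at hid
    exact (memLp_map_measure_iff (by fun_prop) hY.aemeasurable).1 hid
  have hZL : MemLp Z 2 μ := by
    rw [← hZν] at hid
    exact (memLp_map_measure_iff (by fun_prop) hZ.aemeasurable).1 hid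
  have h1 : ∀ {W : Ω → ℝ}, Measurable W → μ.map W = ν → ∫ ω, W ω ∂μ = ∫ y, y ∂ν := by
    intro W hW hWν
    rw [← hWν, integral_map hW.aemeasurable (by fun_prop)]
  have h2 : ∀ {W : Ω → ℝ}, Measurable W → μ.map W = ν → ∫ ω, W ω ^ 2 ∂μ = ∫ y, y ^ 2 ∂ν := by
    intro W hW hWν
    rw [← hWν, integral_map hW.aemeasurable (by fun_prop)]
  have hYZ : Integrable (fun ω => Y ω * Z ω) μ :=
    hind.integrable_mul (hYL.integrable (by norm_num)) (hZL.integrable (by norm_num))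
  have hprod : ∫ ω, Y ω * Z ω ∂μ = (∫ ω, Y ω ∂μ) * ∫ ω, Z ω ∂μ :=
    hind.integral_mul_eq_mul_integral hY.aestronglyMeasurable hZ.aestronglyMeasurable
  have hexp : ∀ ω, (Y ω - Z ω) ^ 2 = Y ω ^ 2 - 2 * (Y ω * Z ω) + Z ω ^ 2 := fun ω => by ring
  simp only [hexp]
  have hsub : Integrable (fun ω => Y ω ^ 2 - 2 * (Y ω * Z ω)) μ :=
    hYL.integrable_sq.sub (hYZ.const_mul 2)
  rw [integral_add hsub hZL.integrable_sq, integral_sub hYL.integrable_sq (hYZ.const_mul 2), integral_const_mul, hprod, h1 hY hYν,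
    h1 hZ hZν, h2 hY hYν, h2 hZ hZν, variance_eq_sub hid]
  simp only [Pi.pow_apply, id]
  ring

end Concentration

/-! ### The decision depends only on finitely many comparisons -/

theorem argmax_congr {N : ℕ} {f g : Fin N → ℝ} (hfg : ∀ i j, f i ≤ f j ↔ g i ≤ g j)
    (S : Finset (Fin N)) (hS : S.Nonempty) : argmax f S hS = argmax g S hS := by
  simp only [argmax, hfg]

/-- The type of outcomes of the comparisons made at a time step. -/
abbrev Code (N : ℕ) : Type :=
  (Fin N → Prop) × (Fin N → Prop) × (Fin N → Fin N → Prop) × (Fin N → Fin N → Prop) ×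
    (Fin N → Fin N → Prop)

/-- The outcomes of the comparisons made at time step `t`. -/
def code {N : ℕ} (v δ : ℝ) (t : ℕ) (h : History N) : Code N :=
  (fun i => ucbVar δ t h i ≤ v, fun i => lcbVar δ t h i ≤ v,
    fun i j => sampleMean h i ≤ sampleMean h j, fun i j => ucbMean δ t h i ≤ ucbMean δ t h j,
    fun i j => lcbMean δ t h i ≤ ucbMean δ t h j)

section Code

variable {N : ℕ} {v δ : ℝ} {t : ℕ} {h h' : History N}

theorem empFeasible_congr (hc : code v δ t h = code v δ t h') (A : Finset (Fin N)) :
    empFeasible v δ t A h = empFeasible v δ t A h' := by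
  simp only [code, Prod.mk.injEq, funext_iff, eq_iff_iff] at hc
  simp only [empFeasible, hc.1]

theorem possFeasible_congr (hc : code v δ t h = code v δ t h') (A : Finset (Fin N)) :
    possFeasible v δ t A h = possFeasible v δ t A h' := by
  rw [possFeasible, possFeasible, empFeasible_congr hc]
  simp only [code, Prod.mk.injEq, funext_iff, eq_iff_iff] at hc
  simp only [empAlmostFeasible, ← not_le, hc.1, hc.2.1]

theorem potential_congr (hc : code v δ t h = code v δ t h') (A : Finset (Fin N)) :
    potential v δ t A h = potential v δ t A h' := by
  have hF := empFeasible_congr hc A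
  simp only [code, Prod.mk.injEq, funext_iff, eq_iff_iff] at hc
  simp only [potential, hF, argmax_congr hc.2.2.1, hc.2.2.2.2]

/-- The action depends on the rewards only through finitely many truth values, so measurability of
the run reduces to measurability of these comparisons. -/
theorem action_congr (hc : code v δ t h = code v δ t h') (A : Finset (Fin N)) :
    action v δ t A h = action v δ t A h' := by
  have hF := empFeasible_congr hc A
  have hA := possFeasible_congr hc A
  have hP := potential_congr hc A
  simp only [code, Prod.mk.injEq, funext_iff, eq_iff_iff] at hc
  simp only [action, hF, hA, hP, argmax_congr hc.2.2.1, argmax_congr hc.2.2.2.1, hc.2.2.2.2]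

end Code

/-! ### Measurability -/

/-- A history with fixed pulled arms whose rewards are functions on `α`. -/
def hist {N : ℕ} {α : Type} (L : List (Fin N × (α → ℝ))) (a : α) : History N :=
  L.map fun p => (p.1, p.2 a)

theorem samples_hist {N : ℕ} {α : Type} (L : List (Fin N × (α → ℝ))) (a : α) (j : Fin N) :
    samples (hist L a) j = ((L.filter fun p => p.1 = j).map Prod.snd).map fun f => f a := by
  induction L with
  | nil => rfl
  | cons p L ih =>
    simp only [samples, hist, List.map_cons, List.filter_cons] at ih ⊢
    by_cases hp : p.1 = j <;> simp_all

theorem samples_append {N : ℕ} (h : History N) (i j : Fin N) (y : ℝ) :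
    samples (h ++ [(i, y)]) j = if i = j then samples h j ++ [y] else samples h j := by
  by_cases hij : i = j <;> simp [samples, List.filter_append, hij]

theorem measurable_list_map_sum {α : Type} [MeasurableSpace α] {fs : List (α → ℝ)}
    (hfs : ∀ f ∈ fs, Measurable f) : Measurable fun a => (fs.map fun f => f a).sum := by
  induction fs with
  | nil => simp
  | cons f fs ih =>
    simp only [List.map_cons, List.sum_cons]
    exact (hfs f (by simp)).add (ih fun g hg => hfs g (by simp [hg]))

theorem measurable_list_map_sq_sum {α : Type} [MeasurableSpace α] {fs : List (α → ℝ)}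
    (hfs : ∀ f ∈ fs, Measurable f) {m : α → ℝ} (hm : Measurable m) :
    Measurable fun a => ((fs.map fun f => f a).map fun y => (y - m a) ^ 2).sum := by
  have := measurable_list_map_sum (fs := fs.map fun f a => (f a - m a) ^ 2) fun g hg => by
    obtain ⟨f, hf, rfl⟩ := List.mem_map.1 hg
    exact ((hfs f hf).sub hm).pow_const 2
  simpa [List.map_map, Function.comp_def] using this

/-- Sample mean of a list. -/
def listMean (s : List ℝ) : ℝ := s.sum / (s.length : ℝ)

/-- Unbiased sample variance of a list. -/
def listVar (s : List ℝ) : ℝ := (s.map fun y => (y - listMean s) ^ 2).sum / ((s.length : ℝ) - 1)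

theorem sampleMean_eq {N : ℕ} (h : History N) (i : Fin N) :
    sampleMean h i = listMean (samples h i) := rfl

theorem sampleVar_eq {N : ℕ} (h : History N) (i : Fin N) :
    sampleVar h i = listVar (samples h i) := rfl

theorem measurable_listMean {α : Type} [MeasurableSpace α] {fs : List (α → ℝ)}
    (hfs : ∀ f ∈ fs, Measurable f) : Measurable fun a => listMean (fs.map fun f => f a) := by
  simp only [listMean, List.length_map]
  exact (measurable_list_map_sum hfs).div_const _

theorem measurable_listVar {α : Type} [MeasurableSpace α] {fs : List (α → ℝ)}
    (hfs : ∀ f ∈ fs, Measurable f) : Measurable fun a => listVar (fs.map fun f => f a) := by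
  simp only [listVar, List.length_map]
  exact (measurable_list_map_sq_sum hfs (measurable_listMean hfs)).div_const _

theorem measurableSet_of_countable_partition {α κ : Type*} [MeasurableSpace α]
    [MeasurableSpace κ] [Countable κ] [MeasurableSingletonClass κ] {c : α → κ}
    (hc : Measurable c) {S : Set α}
    (h : ∀ b, ∃ T, MeasurableSet T ∧ ∀ a, c a = c b → (a ∈ S ↔ a ∈ T)) : MeasurableSet S := by
  choose T hT hST using h
  have : S = ⋃ k : κ, {a | c a = k ∧ ∃ b, c b = k} ∩ S := by
    ext a
    simp
  rw [this]
  refine MeasurableSet.iUnion fun k => ?_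
  by_cases hk : ∃ b, c b = k
  · obtain ⟨b, rfl⟩ := hk
    have e : {a | c a = c b ∧ ∃ b', c b' = c b} ∩ S = c ⁻¹' {c b} ∩ T b := by
      ext a
      simp only [Set.mem_inter_iff, Set.mem_ofPred_eq, Set.mem_preimage, Set.mem_singleton_iff]
      exact ⟨fun ⟨⟨h1, _⟩, h2⟩ => ⟨h1, (hST b a h1).1 h2⟩,
        fun ⟨h1, h2⟩ => ⟨⟨h1, b, rfl⟩, (hST b a h1).2 h2⟩⟩
    rw [e]
    exact (hc (measurableSet_singleton _)).inter (hT b)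
  · have e : {a | c a = k ∧ ∃ b, c b = k} ∩ S = ∅ := by
      ext a
      simp [hk]
    rw [e]
    exact MeasurableSet.empty

section Measurability

variable {N : ℕ} {α : Type} [MeasurableSpace α] {L : List (Fin N × (α → ℝ))}

theorem measurable_of_mem_samples (hL : ∀ p ∈ L, Measurable p.2) (j : Fin N) :
    ∀ f ∈ (L.filter fun p => p.1 = j).map Prod.snd, Measurable f := by
  intro f hf
  obtain ⟨p, hp, rfl⟩ := List.mem_map.1 hf
  exact hL p (List.mem_of_mem_filter hp)

theorem measurable_code (hL : ∀ p ∈ L, Measurable p.2) (v δ : ℝ) (t : ℕ) :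
    Measurable fun a => code v δ t (hist L a) := by
  have hpulls : ∀ a j, pulls (hist L a) j = (L.filter fun p => p.1 = j).length := by
    intro a j
    simp only [pulls, samples_hist, List.length_map]
  have hmean : ∀ j, Measurable fun a => sampleMean (hist L a) j := by
    intro j
    simp only [sampleMean_eq, samples_hist]
    exact measurable_listMean (measurable_of_mem_samples hL j)
  have hvar : ∀ j, Measurable fun a => sampleVar (hist L a) j := by
    intro j
    simp only [sampleVar_eq, samples_hist]
    exact measurable_listVar (measurable_of_mem_samples hL j)
  have hrad : ∀ j, Measurable fun a => radius N δ t (pulls (hist L a) j) := by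
    intro j
    simp only [hpulls]
    exact measurable_const
  have hle : ∀ {f g : α → ℝ}, Measurable f → Measurable g → Measurable fun a => f a ≤ g a :=
    fun hf hg => measurableSet_setOfPred.1 (measurableSet_le hf hg)
  refine Measurable.prodMk ?_ (Measurable.prodMk ?_ (Measurable.prodMk ?_
    (Measurable.prodMk ?_ ?_)))
  · exact measurable_pi_iff.2 fun i => hle ((hvar i).add (hrad i)) measurable_const
  · exact measurable_pi_iff.2 fun i => hle ((hvar i).sub (hrad i)) measurable_const
  · exact measurable_pi_iff.2 fun i => measurable_pi_iff.2 fun j => hle (hmean i) (hmean j)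
  · exact measurable_pi_iff.2 fun i => measurable_pi_iff.2 fun j =>
      hle ((hmean i).add (hrad i)) ((hmean j).add (hrad j))
  · exact measurable_pi_iff.2 fun i => measurable_pi_iff.2 fun j =>
      hle ((hmean i).sub (hrad i)) ((hmean j).add (hrad j))

end Measurability

/-! ### Integrating out one entry of the reward table -/

theorem measurable_eraseRow {N : ℕ} {Ω : Type*} [MeasurableSpace Ω] {X : ℕ → Fin N → Ω → ℝ}
    {r : ℕ} (hX : ∀ r' ≠ r, ∀ i, Measurable (X r' i)) :
    Measurable fun ω (r' : ℕ) (i : Fin N) => if r' = r then 0 else X r' i ω := by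
  refine measurable_pi_iff.2 fun r' => measurable_pi_iff.2 fun i => ?_
  by_cases hr : r' = r
  · simp [hr]
  · simpa [hr] using hX r' hr i

/-- Since `Φ` ignores row `r` of the table, the table may be replaced by `Z`, in which this row is
blanked. `Z` is independent of the entry, which Fubini then integrates out. -/
theorem measure_eq_lintegral_entry {N : ℕ} {Ω : Type*} [MeasurableSpace Ω] {P : Measure Ω}
    [IsProbabilityMeasure P] {X : ℕ → Fin N → Ω → ℝ} (hmeas : ∀ r i, Measurable (X r i))
    (hindep : iIndepFun (fun p : ℕ × Fin N => X p.1 p.2) P) (r : ℕ) (i : Fin N)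
    {Φ : ℝ → (ℕ → Fin N → ℝ) → Prop}
    (hΦ : MeasurableSet {p : ℝ × (ℕ → Fin N → ℝ) | Φ p.1 p.2})
    (hloc : ∀ y x x', (∀ r' i', r' ≠ r → x r' i' = x' r' i') → (Φ y x → Φ y x')) :
    P {ω | Φ (X r i ω) fun r i => X r i ω} =
      ∫⁻ y, P {ω | Φ y fun r i => X r i ω} ∂(P.map (X r i)) := by
  set Z : Ω → ℕ → Fin N → ℝ := fun ω r' i' => if r' = r then 0 else X r' i' ω with hZ
  have hΦZ : ∀ y ω, Φ y (fun r i => X r i ω) ↔ Φ y (Z ω) := by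
    intro y ω
    constructor
    · exact hloc y _ _ fun r' i' hr => by simp [hZ, hr]
    · exact hloc y _ _ fun r' i' hr => by simp [hZ, hr]
  have hZm : Measurable Z := measurable_eraseRow fun r' _ i' => hmeas r' i'
  have hind : IndepFun (X r i) Z P := by
    refine indepFun_of_disjoint (ξ := fun p : ℕ × Fin N => X p.1 p.2) (fun p => hmeas p.1 p.2)
      hindep (S := {(r, i)}) (T := {p | p.1 ≠ r}) (by simp) ?_ ?_
    · exact measurable_sigmaOf (fun p : ℕ × Fin N => X p.1 p.2) (i := (r, i)) rfl
    · exact @measurable_eraseRow N Ω (sigmaOf _ _) X r fun r' hr i' =>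
        measurable_sigmaOf (fun p : ℕ × Fin N => X p.1 p.2) (i := (r', i')) hr
  simp only [hΦZ]
  have h1 : P {ω | Φ (X r i ω) (Z ω)} =
      P.map (fun ω => (X r i ω, Z ω)) {p : ℝ × (ℕ → Fin N → ℝ) | Φ p.1 p.2} := by
    rw [Measure.map_apply ((hmeas r i).prodMk hZm) hΦ]
    rfl
  have : IsProbabilityMeasure (P.map Z) := Measure.isProbabilityMeasure_map hZm.aemeasurable
  rw [h1, (indepFun_iff_map_prod_eq_prod_map_map (hmeas r i).aemeasurable
    hZm.aemeasurable).1 hind, Measure.prod_apply hΦ]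
  refine lintegral_congr fun y => ?_
  rw [Measure.map_apply hZm (measurable_prodMk_left hΦ)]
  rfl

/-! ### Optional skipping -/

/-- A property of a reward list that is measurable in rewards. -/
def MeasurableOnLists (F : List ℝ → Prop) : Prop :=
  ∀ {α : Type} [MeasurableSpace α] (fs : List (α → ℝ)), (∀ f ∈ fs, Measurable f) →
    MeasurableSet {a | F (fs.map fun f => f a)}

/-- `Ψ h x` is an event about the continuation on the reward table `x` of an execution with
history `h`; its probability is at most `G` of the rewards observed from arm `j`. -/
structure Controlled {N : ℕ} {Ω : Type*} [MeasurableSpace Ω] (P : Measure Ω)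
    (X : ℕ → Fin N → Ω → ℝ) (j : Fin N) (G : List ℝ → ENNReal)
    (Ψ : History N → (ℕ → Fin N → ℝ) → Prop) : Prop where
  meas : ∀ {α : Type} [MeasurableSpace α] (L : List (Fin N × (α → ℝ)))
    (x : α → ℕ → Fin N → ℝ), (∀ p ∈ L, Measurable p.2) → Measurable x →
    MeasurableSet {a | Ψ (hist L a) (x a)}
  loc : ∀ h x x', (∀ r i, h.length ≤ r → x r i = x' r i) → Ψ h x → Ψ h x'
  bound : ∀ h, P {ω | Ψ h fun r i => X r i ω} ≤ G (samples h j)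

section Skipping

variable {N : ℕ} {Ω : Type*} [MeasurableSpace Ω] {P : Measure Ω} [IsProbabilityMeasure P]
  {X : ℕ → Fin N → Ω → ℝ} {ν : Fin N → Measure ℝ} {j : Fin N} {G : List ℝ → ENNReal}

/-- The reward sits in row `h.length`, which the continuation no longer reads, so it can be
integrated out. If the pulled arm is `j`, `hG` absorbs the integral; otherwise the sample of `j` is
unchanged. -/
theorem Controlled.pull (hmeas : ∀ r i, Measurable (X r i)) (hlaw : ∀ r i, P.map (X r i) = ν i)
    (hindep : iIndepFun (fun p : ℕ × Fin N => X p.1 p.2) P)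
    (hG : ∀ s, ∫⁻ y, G (s ++ [y]) ∂(ν j) ≤ G s) {Ψ : History N → (ℕ → Fin N → ℝ) → Prop}
    (hΨ : Controlled P X j G Ψ) (i : Fin N) :
    Controlled P X j G fun h x => Ψ (VALUCB.pull x h i) x where
  meas := by
    intro α _ L x hL hx
    have h1 := hΨ.meas (L ++ [(i, fun a => x a L.length i)]) x (by
      intro p hp
      rcases List.mem_append.1 hp with hp | hp
      · exact hL p hp
      · rw [List.mem_singleton.1 hp]
        exact measurable_pi_iff.1 (measurable_pi_iff.1 hx _) _) hx
    convert h1 using 3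
    simp [VALUCB.pull, hist]
  loc := by
    intro h x x' hx hΨh
    have e : VALUCB.pull x' h i = VALUCB.pull x h i := by
      simp [VALUCB.pull, hx h.length i le_rfl]
    rw [e]
    refine hΨ.loc _ x x' (fun r i' hr => hx r i' ?_) hΨh
    simp only [VALUCB.pull, List.length_append, List.length_singleton] at hr
    omega
  bound := by
    intro h
    have hν : IsProbabilityMeasure (ν i) :=
      hlaw 0 i ▸ Measure.isProbabilityMeasure_map (hmeas 0 i).aemeasurable
    have hΦ : MeasurableSet
        {p : ℝ × (ℕ → Fin N → ℝ) | Ψ (h ++ [(i, p.1)]) p.2} := by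
      have h1 := hΨ.meas (α := ℝ × (ℕ → Fin N → ℝ))
        (h.map (fun q => (q.1, fun _ => q.2)) ++ [(i, fun p => p.1)]) (fun p => p.2) (by
          intro p hp
          rcases List.mem_append.1 hp with hp | hp
          · obtain ⟨q, _, rfl⟩ := List.mem_map.1 hp
            exact measurable_const
          · rw [List.mem_singleton.1 hp]
            exact measurable_fst) measurable_snd
      convert h1 using 3
      simp [hist, Function.comp_def]
    calc P {ω | Ψ (VALUCB.pull (fun r i => X r i ω) h i) fun r i => X r i ω}
        = ∫⁻ y, P {ω | Ψ (h ++ [(i, y)]) fun r i => X r i ω} ∂(P.map (X h.length i)) :=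
          measure_eq_lintegral_entry hmeas hindep h.length i
            (Φ := fun y x => Ψ (h ++ [(i, y)]) x) hΦ fun y x x' hx =>
              hΨ.loc _ x x' fun r i' hr => hx r i' (by
                simp only [List.length_append, List.length_singleton] at hr
                omega)
      _ ≤ ∫⁻ y, G (samples (h ++ [(i, y)]) j) ∂(ν i) := by
          rw [hlaw]
          exact lintegral_mono fun y => hΨ.bound _
      _ ≤ G (samples h j) := by
          by_cases hij : i = j
          · subst hij
            simpa [samples_append] using hG (samples h i)
          · simp [samples_append, hij]

/-- `k` consecutive time steps, starting at time step `t`. -/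
def runFrom (v δ : ℝ) (x : ℕ → Fin N → ℝ) : ℕ → ℕ → Config N → Config N
  | 0, _, z => z
  | k + 1, t, z => runFrom v δ x k (t + 1) (step v δ x t z)

theorem runFrom_stopped (v δ : ℝ) (x : ℕ → Fin N → ℝ) (k t τ : ℕ) (h : History N)
    (answer : Option (Fin N)) :
    runFrom v δ x k t (Config.stopped τ h answer) = Config.stopped τ h answer := by
  induction k generalizing t with
  | zero => rfl
  | succ k ih => exact ih _

theorem runFrom_succ (v δ : ℝ) (x : ℕ → Fin N → ℝ) (k t : ℕ) (z : Config N) :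
    runFrom v δ x (k + 1) t z = step v δ x (t + k) (runFrom v δ x k t z) := by
  induction k generalizing t z with
  | zero => rfl
  | succ k ih =>
    rw [runFrom, ih, runFrom]
    congr 1
    omega

theorem config_eq_runFrom (v δ : ℝ) (x : ℕ → Fin N → ℝ) (k : ℕ) :
    config v δ x k = runFrom v δ x k (N + 1) (Config.running Finset.univ (warmUp x)) := by
  induction k with
  | zero => rfl
  | succ k ih => rw [runFrom_succ, ← ih, config]

/-- The execution is still running and the rewards observed from arm `j` satisfy `F`. -/
def RunningWith (j : Fin N) (F : List ℝ → Prop) : Config N → Prop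
  | Config.running _ h => F (samples h j)
  | Config.stopped _ _ _ => False

/-- Backward induction with `G` as a supermartingale above the indicator of `F`. Once `h` is fixed,
so is the next action: it is a halt, which makes the event impossible, or one or two uses of
`Controlled.pull`. -/
theorem controlled_runFrom (hmeas : ∀ r i, Measurable (X r i))
    (hlaw : ∀ r i, P.map (X r i) = ν i)
    (hindep : iIndepFun (fun p : ℕ × Fin N => X p.1 p.2) P)
    (hG : ∀ s, ∫⁻ y, G (s ++ [y]) ∂(ν j) ≤ G s) {F : List ℝ → Prop} (hF : MeasurableOnLists F)
    (hFG : ∀ s, F s → 1 ≤ G s) (v δ : ℝ) (k t : ℕ) (A : Finset (Fin N)) :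
    Controlled P X j G fun h x =>
      RunningWith j F (runFrom v δ x k t (Config.running A h)) := by
  induction k generalizing t A with
  | zero =>
    refine ⟨?_, fun _ _ _ _ h => h, ?_⟩
    · intro α _ L x hL _
      simp only [runFrom, RunningWith, samples_hist]
      exact hF _ (measurable_of_mem_samples hL j)
    · intro h
      by_cases hh : F (samples h j)
      · exact prob_le_one.trans (hFG _ hh)
      · simp [runFrom, RunningWith, hh]
  | succ k ih =>
    -- The event agrees with a controlled one on the whole cell of histories sharing the `code` of
    -- `h`, as measurability requires; the other two properties only use `h` itself.
    have key : ∀ h : History N, ∃ Ψ : History N → (ℕ → Fin N → ℝ) → Prop,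
        Controlled P X j G Ψ ∧ ∀ h' x, code v δ t h' = code v δ t h →
          (RunningWith j F (runFrom v δ x (k + 1) t (Config.running A h')) ↔ Ψ h' x) := by
      intro h
      rcases hact : action v δ t A h with answer | i | ⟨i, c⟩
      · refine ⟨fun _ _ => False, ⟨?_, fun _ _ _ _ h => h, ?_⟩, ?_⟩
        · intros
          simp
        · intros
          simp
        · intro h' x hc
          simp [runFrom, step, action_congr hc, hact, runFrom_stopped, RunningWith]
      · refine ⟨_, (ih (t + 1) (possFeasible v δ t A h)).pull hmeas hlaw hindep hG i, ?_⟩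
        intro h' x hc
        simp [runFrom, step, action_congr hc, possFeasible_congr hc, hact]
      · refine ⟨_, ((ih (t + 1) (possFeasible v δ t A h)).pull hmeas hlaw hindep hG c).pull
          hmeas hlaw hindep hG i, ?_⟩
        intro h' x hc
        simp [runFrom, step, action_congr hc, possFeasible_congr hc, hact]
    refine ⟨?_, ?_, ?_⟩
    · intro α _ L x hL hx
      refine measurableSet_of_countable_partition (measurable_code hL v δ t) fun b => ?_
      obtain ⟨Ψ, hΨ, hiff⟩ := key (hist L b)
      exact ⟨_, hΨ.meas L x hL hx, fun a ha => hiff (hist L a) (x a) ha⟩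
    · intro h x x' hx hrun
      obtain ⟨Ψ, hΨ, hiff⟩ := key h
      exact (hiff h x' rfl).2 (hΨ.loc h x x' hx ((hiff h x rfl).1 hrun))
    · intro h
      obtain ⟨Ψ, hΨ, hiff⟩ := key h
      simp only [fun x => hiff h x rfl]
      exact hΨ.bound h

theorem Controlled.foldl_pull (hmeas : ∀ r i, Measurable (X r i))
    (hlaw : ∀ r i, P.map (X r i) = ν i)
    (hindep : iIndepFun (fun p : ℕ × Fin N => X p.1 p.2) P)
    (hG : ∀ s, ∫⁻ y, G (s ++ [y]) ∂(ν j) ≤ G s) {Ψ : History N → (ℕ → Fin N → ℝ) → Prop}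
    (hΨ : Controlled P X j G Ψ) (l : List (Fin N)) :
    Controlled P X j G fun h x => Ψ (l.foldl (VALUCB.pull x) h) x := by
  induction l with
  | nil => exact hΨ
  | cons i l ih => exact ih.pull hmeas hlaw hindep hG i

/-- The probability that the execution is running after `k` time steps and that arm `j` has
produced `n` rewards with property `F` is at most that of property `F` for the first `n` entries
of the corresponding column of the reward table. -/
theorem measure_config_le (hmeas : ∀ r i, Measurable (X r i))
    (hlaw : ∀ r i, P.map (X r i) = ν i)
    (hindep : iIndepFun (fun p : ℕ × Fin N => X p.1 p.2) P) {F : List ℝ → Prop}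
    (hF : MeasurableOnLists F) {n : ℕ} (hn : ∀ s, F s → s.length = n) (v δ : ℝ) (k : ℕ) :
    P {ω | RunningWith j F (config v δ (fun r i => X r i ω) k)} ≤
      P {ω | F ((List.range n).map fun r => X r j ω)} := by
  -- The probability of `F` once `s` is topped up to length `n` with fresh rewards. Adding one
  -- reward preserves it on average while `s` is shorter than `n`, and makes it vanish afterwards;
  -- at `[]` it is the right-hand side.
  set G : List ℝ → ENNReal := fun s =>
    P {ω | F (s ++ (List.range' s.length (n - s.length)).map fun r => X r j ω)} with hGdef
  have hG : ∀ s, ∫⁻ y, G (s ++ [y]) ∂(ν j) ≤ G s := by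
    intro s
    by_cases hs : s.length < n
    · obtain ⟨m, hm⟩ : ∃ m, n - s.length = m + 1 := ⟨n - s.length - 1, by omega⟩
      have hm' : n - (s.length + 1) = m := by omega
      refine le_of_eq ?_
      simp only [hGdef, hm, hm', List.range'_succ, List.map_cons, List.length_append,
        List.length_singleton, List.append_assoc, List.singleton_append]
      rw [← hlaw s.length j]
      refine (measure_eq_lintegral_entry hmeas hindep s.length j (Φ := fun y x =>
        F (s ++ y :: (List.range' (s.length + 1) m).map fun r => x r j)) ?_ ?_).symm
      · have := hF (α := ℝ × (ℕ → Fin N → ℝ)) (s.map (fun y _ => y) ++ (fun p => p.1) ::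
          (List.range' (s.length + 1) m).map fun r p => p.2 r j) (by
            intro f hf
            rcases List.mem_append.1 hf with hf | hf
            · obtain ⟨y, _, rfl⟩ := List.mem_map.1 hf
              exact measurable_const
            · rcases List.mem_cons.1 hf with rfl | hf
              · exact measurable_fst
              · obtain ⟨r, _, rfl⟩ := List.mem_map.1 hf
                fun_prop)
        simpa [Function.comp_def] using this
      · intro y x x' hx hFx
        have e : (List.range' (s.length + 1) m).map (fun r => x r j) =
            (List.range' (s.length + 1) m).map fun r => x' r j :=
          List.map_congr_left fun r hr => hx r j (by
            have := List.mem_range'_1.1 hr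
            omega)
        rwa [← e]
    · have : ∀ y, G (s ++ [y]) = 0 := by
        intro y
        refine measure_mono_null (t := ∅) (fun ω hω => ?_) measure_empty
        have := hn _ hω
        simp only [List.length_append, List.length_singleton, List.length_map,
          List.length_range'] at this
        omega
      simp [this]
  have hFG : ∀ s, F s → 1 ≤ G s := by
    intro s hs
    have := hn s hs
    simp [hGdef, this, hs]
  have h := ((controlled_runFrom hmeas hlaw hindep hG hF hFG v δ k (N + 1)
    Finset.univ).foldl_pull hmeas hlaw hindep hG (List.finRange N ++ List.finRange N)).bound []
  simp only [config_eq_runFrom]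
  refine h.trans (le_of_eq ?_)
  simp [hGdef, samples, List.range_eq_range']

end Skipping

/-! ### Numbers of pulls -/

theorem pulls_append {N : ℕ} (h : History N) (i j : Fin N) (y : ℝ) :
    pulls (h ++ [(i, y)]) j = pulls h j + if i = j then 1 else 0 := by
  rw [pulls, samples_append]
  split_ifs <;> simp [pulls]

theorem pulls_pull {N : ℕ} (x : ℕ → Fin N → ℝ) (h : History N) (i j : Fin N) :
    pulls (pull x h i) j = pulls h j + if i = j then 1 else 0 := pulls_append h i j _

theorem pull_length {N : ℕ} (x : ℕ → Fin N → ℝ) (h : History N) (i : Fin N) :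
    (pull x h i).length = h.length + 1 := by simp [pull]

theorem pulls_foldl_pull {N : ℕ} (x : ℕ → Fin N → ℝ) (l : List (Fin N)) (h : History N)
    (j : Fin N) : pulls (l.foldl (pull x) h) j = pulls h j + l.count j := by
  induction l generalizing h with
  | nil => simp
  | cons i l ih =>
    rw [List.foldl_cons, ih, pulls_pull, List.count_cons]
    by_cases hij : i = j <;> simp [hij]
    omega

theorem foldl_pull_length {N : ℕ} (x : ℕ → Fin N → ℝ) (l : List (Fin N)) (h : History N) :
    (l.foldl (pull x) h).length = h.length + l.length := by
  induction l generalizing h with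
  | nil => simp
  | cons i l ih =>
    rw [List.foldl_cons, ih, pull_length, List.length_cons]
    omega

theorem pulls_warmUp {N : ℕ} (x : ℕ → Fin N → ℝ) (j : Fin N) : pulls (warmUp x) j = 2 := by
  have h1 : (List.finRange N).count j = 1 :=
    List.count_eq_one_of_mem (List.nodup_finRange N) (List.mem_finRange j)
  rw [warmUp, pulls_foldl_pull, List.count_append, h1]
  rfl

theorem warmUp_length {N : ℕ} (x : ℕ → Fin N → ℝ) : (warmUp x).length = 2 * N := by
  rw [warmUp, foldl_pull_length]
  simp
  omega

theorem argmax_mem {N : ℕ} (f : Fin N → ℝ) (S : Finset (Fin N)) (hS : S.Nonempty) :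
    argmax f S hS ∈ S :=
  (Finset.mem_filter.1 (Finset.min'_mem _ (argmax_aux f S hS))).1

theorem le_argmax {N : ℕ} (f : Fin N → ℝ) (S : Finset (Fin N)) (hS : S.Nonempty) {j : Fin N}
    (hj : j ∈ S) : f j ≤ f (argmax f S hS) :=
  (Finset.mem_filter.1 (Finset.min'_mem _ (argmax_aux f S hS))).2 j hj

/-- The two arms pulled at a time step are different. -/
theorem ne_of_action_eq_pullTwo {N : ℕ} {v δ : ℝ} {t : ℕ} {A : Finset (Fin N)} {h : History N}
    {i c : Fin N} (hact : action v δ t A h = Action.pullTwo i c) : c ≠ i := by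
  unfold action at hact
  split_ifs at hact with hP
  dsimp only at hact
  split_ifs at hact with hc hL
  obtain ⟨rfl, rfl⟩ := Action.pullTwo.inj hact
  exact Finset.ne_of_mem_erase (argmax_mem _ _ hc)

/-- What precedes a running configuration. -/
theorem exists_of_config_succ_eq_running {N : ℕ} {v δ : ℝ} {x : ℕ → Fin N → ℝ} {k : ℕ}
    {A : Finset (Fin N)} {h : History N} (hk : config v δ x (k + 1) = Config.running A h) :
    ∃ A' h', config v δ x k = Config.running A' h' ∧ A = possFeasible v δ (N + 1 + k) A' h' ∧
      ((∃ i, action v δ (N + 1 + k) A' h' = Action.pullOne i ∧ h = pull x h' i) ∨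
        ∃ i c, action v δ (N + 1 + k) A' h' = Action.pullTwo i c ∧
          h = pull x (pull x h' i) c) := by
  rw [config] at hk
  rcases hz : config v δ x k with ⟨A', h'⟩ | ⟨τ, h', answer⟩
  · refine ⟨A', h', rfl, ?_⟩
    rw [hz] at hk
    rcases hact : action v δ (N + 1 + k) A' h' with answer | i | ⟨i, c⟩
    · simp [step, hact] at hk
    · simp only [step, hact, Config.running.injEq] at hk
      exact ⟨hk.1.symm, Or.inl ⟨i, rfl, hk.2.symm⟩⟩
    · simp only [step, hact, Config.running.injEq] at hk
      exact ⟨hk.1.symm, Or.inr ⟨i, c, rfl, hk.2.symm⟩⟩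
  · simp [hz, step] at hk

/-- The two arms of a step are distinct, so a step adds at most one pull per arm. This leaves only
`k + 1` values for the union bound. -/
theorem pulls_config {N : ℕ} {v δ : ℝ} {x : ℕ → Fin N → ℝ} {k : ℕ} {A : Finset (Fin N)}
    {h : History N} (hk : config v δ x k = Config.running A h) (j : Fin N) :
    2 ≤ pulls h j ∧ pulls h j ≤ k + 2 := by
  induction k generalizing A h with
  | zero =>
    simp only [config, Config.running.injEq] at hk
    rw [← hk.2, pulls_warmUp]
    omega
  | succ k ih =>
    obtain ⟨A', h', hk', -, ⟨i, -, rfl⟩ | ⟨i, c, hact, rfl⟩⟩ := exists_of_config_succ_eq_running hk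
    · have := ih hk'
      rw [pulls_pull]
      split_ifs <;> omega
    · have := ih hk'
      have hne := ne_of_action_eq_pullTwo hact
      rw [pulls_pull, pulls_pull]
      by_cases h1 : i = j
      · rw [if_pos h1, if_neg (by rintro rfl; exact hne h1.symm)]
        omega
      · rw [if_neg h1]
        split_ifs <;> omega

theorem length_config {N : ℕ} {v δ : ℝ} {x : ℕ → Fin N → ℝ} {k : ℕ} {A : Finset (Fin N)}
    {h : History N} (hk : config v δ x k = Config.running A h) : h.length ≤ 2 * (N + k) := by
  induction k generalizing A h with
  | zero =>
    simp only [config, Config.running.injEq] at hk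
    rw [← hk.2, warmUp_length]
    omega
  | succ k ih =>
    obtain ⟨A', h', hk', -, ⟨i, -, rfl⟩ | ⟨i, c, hact, rfl⟩⟩ := exists_of_config_succ_eq_running hk
    · have := ih hk'
      rw [pull_length]
      omega
    · have := ih hk'
      rw [pull_length, pull_length]
      omega

/-! ### The good event -/

/-- On the reward table `x`, all confidence intervals are correct at all time steps. -/
def Accurate {N : ℕ} (ν : Fin N → Measure ℝ) (v δ : ℝ) (x : ℕ → Fin N → ℝ) : Prop :=
  ∀ k A h, config v δ x k = Config.running A h → ∀ j,
    |sampleMean h j - mean ν j| ≤ radius N δ (N + 1 + k) (pulls h j) ∧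
      |sampleVar h j - var ν j| ≤ radius N δ (N + 1 + k) (pulls h j)

/-- A list of `n` rewards whose sample mean or sample variance deviates by more than `ρ`. -/
def Deviates (n : ℕ) (m s2 ρ : ℝ) (s : List ℝ) : Prop :=
  s.length = n ∧ (ρ < |listMean s - m| ∨ ρ < |listVar s - s2|)

theorem measurableOnLists_deviates (n : ℕ) (m s2 ρ : ℝ) :
    MeasurableOnLists (Deviates n m s2 ρ) := by
  intro α _ fs hfs
  simp only [Deviates, List.length_map]
  refine (MeasurableSet.const _).inter (MeasurableSet.union ?_ ?_)
  · exact measurableSet_lt measurable_const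
      (continuous_abs.measurable.comp ((measurable_listMean hfs).sub_const m))
  · exact measurableSet_lt measurable_const
      (continuous_abs.measurable.comp ((measurable_listVar hfs).sub_const s2))

theorem measure_deviates_le {Ω : Type*} [MeasurableSpace Ω] {P : Measure Ω}
    [IsProbabilityMeasure P] {ξ : ℕ → Ω → ℝ} (hξ : ∀ r, Measurable (ξ r))
    (hind : iIndepFun ξ P) {μ : Measure ℝ} [IsProbabilityMeasure μ] (hlaw : ∀ r, P.map (ξ r) = μ)
    (hsupp : ∀ᵐ y ∂μ, y ∈ Set.Icc (0 : ℝ) 1) {n : ℕ} (hn : 2 ≤ n) {ρ : ℝ} (hρ : 0 ≤ ρ) :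
    P {ω | Deviates n (∫ y, y ∂μ) (variance id μ) ρ ((List.range n).map fun r => ξ r ω)} ≤
      ENNReal.ofReal (4 * Real.exp (-(2 * n * ρ ^ 2))) := by
  have hb : ∀ r, ∀ᵐ ω ∂P, ξ r ω ∈ Set.Icc (0 : ℝ) 1 := fun r =>
    ae_of_ae_map (hξ r).aemeasurable (by rw [hlaw r]; exact hsupp)
  have hm : ∀ r, ∫ ω, ξ r ω ∂P = ∫ y, y ∂μ := fun r => by
    rw [← hlaw r, integral_map (hξ r).aemeasurable (by fun_prop)]
  have hind' : iIndepFun (fun i : Fin n => ξ i) P := hind.precomp Fin.val_injective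
  have h1 := sum_div_tail (fun i : Fin n => hξ i) hind' (fun i => hb i) (fun i => hm i)
    (by omega) hρ
  have h2 := sampleVar_tail (fun i : Fin n => hξ i) hind' (fun i => hb i) (fun i j hij =>
    integral_sq_sub_of_iid (hξ i) (hξ j) (hind.indepFun fun h => hij (Fin.ext h)) (hlaw i)
      (hlaw j) hsupp) hn hρ
  have hsum : ∀ f : ℕ → ℝ, ((List.range n).map f).sum = ∑ i : Fin n, f i := fun f => by
    rw [← Finset.sum_range f]
    rfl
  have hsub : {ω | Deviates n (∫ y, y ∂μ) (variance id μ) ρ ((List.range n).map fun r => ξ r ω)} ⊆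
      {ω | ρ < |(∑ i : Fin n, ξ i ω) / n - ∫ y, y ∂μ|} ∪
      {ω | ρ < |(∑ i : Fin n, (ξ i ω - (∑ j : Fin n, ξ j ω) / n) ^ 2) / (n - 1) -
        variance id μ|} := by
    rintro ω ⟨-, h | h⟩
    · left
      rw [Set.mem_ofPred_eq]
      simpa only [listMean, hsum, List.length_map, List.length_range] using h
    · right
      rw [Set.mem_ofPred_eq]
      simpa only [listVar, listMean, List.map_map, Function.comp_def, hsum, List.length_map,
        List.length_range] using h
  refine ENNReal.le_ofReal_iff_toReal_le (measure_ne_top _ _) (by positivity) |>.2 ?_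
  calc P.real _ ≤ P.real _ := measureReal_mono hsub
    _ ≤ _ := measureReal_union_le _ _
    _ ≤ _ := by linarith

theorem radius_nonneg (N : ℕ) (δ : ℝ) (t T : ℕ) : 0 ≤ radius N δ t T := Real.sqrt_nonneg _

theorem exp_radius {N : ℕ} (hN : 1 ≤ N) {δ : ℝ} (hδ0 : 0 < δ) (hδ1 : δ < 1) {t n : ℕ}
    (ht : 1 ≤ t) (hn : 1 ≤ n) :
    Real.exp (-(2 * n * radius N δ t n ^ 2)) = δ / (2 * N * t ^ 4) := by
  have hN' : (1 : ℝ) ≤ N := by exact_mod_cast hN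
  have ht' : (1 : ℝ) ≤ t := by exact_mod_cast ht
  have hn' : (1 : ℝ) ≤ n := by exact_mod_cast hn
  have ht4 : (1 : ℝ) ≤ (t : ℝ) ^ 4 := one_le_pow₀ ht'
  have harg : 1 ≤ 2 * (N : ℝ) * (t : ℝ) ^ 4 / δ := by
    rw [le_div_iff₀ hδ0]
    nlinarith
  have hlog := Real.log_nonneg harg
  rw [radius, Real.sq_sqrt (by positivity)]
  have e : 2 * (n : ℝ) * (1 / (2 * n) * Real.log (2 * N * t ^ 4 / δ)) =
      Real.log (2 * N * t ^ 4 / δ) := by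
    field_simp
  rw [e, Real.exp_neg, Real.exp_log (by linarith), inv_div]

/-! ### Probability of the good event -/

section

variable {N : ℕ} {Ω : Type*} [MeasurableSpace Ω] {P : Measure Ω} [IsProbabilityMeasure P]
  {X : ℕ → Fin N → Ω → ℝ} {ν : Fin N → Measure ℝ} [∀ i, IsProbabilityMeasure (ν i)]

/-- Union bound over time step, arm and number of pulls. With `t = N + 1 + k`, each term costs at
most `2δ / (N t⁴)` and there are `N (k + 1) ≤ N t` of them; then `2δ / t³ ≤ δ / (t - 1) - δ / t`
telescopes to at most `δ / N`. -/
theorem measure_not_accurate_le (hN : 2 ≤ N) (hsupp : ∀ i, ∀ᵐ y ∂(ν i), y ∈ Set.Icc (0 : ℝ) 1)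
    (v : ℝ) {δ : ℝ} (hδ0 : 0 < δ) (hδ1 : δ < 1) (hmeas : ∀ r i, Measurable (X r i))
    (hlaw : ∀ r i, P.map (X r i) = ν i)
    (hindep : iIndepFun (fun p : ℕ × Fin N => X p.1 p.2) P) :
    P {ω | ¬ Accurate ν v δ fun r i => X r i ω} ≤ ENNReal.ofReal δ := by
  set B : ℕ → Fin N → ℕ → Set Ω := fun k j n =>
    {ω | RunningWith j (Deviates n (mean ν j) (var ν j) (radius N δ (N + 1 + k) n))
      (config v δ (fun r i => X r i ω) k)} with hB
  have hsub : {ω | ¬ Accurate ν v δ fun r i => X r i ω} ⊆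
      ⋃ k, ⋃ j ∈ (Finset.univ : Finset (Fin N)), ⋃ n ∈ Finset.Icc 2 (k + 2), B k j n := by
    intro ω hω
    simp only [Accurate, Set.mem_ofPred_eq, not_forall, not_and_or, not_le] at hω
    obtain ⟨k, A, h, hk, j, hj⟩ := hω
    simp only [Set.mem_iUnion]
    refine ⟨k, j, Finset.mem_univ j, pulls h j, Finset.mem_Icc.2 (pulls_config hk j), ?_⟩
    simp only [hB, Set.mem_ofPred_eq, hk, RunningWith]
    exact ⟨rfl, hj⟩
  have hbound : ∀ k j, ∀ n ∈ Finset.Icc 2 (k + 2), P (B k j n) ≤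
      ENNReal.ofReal (2 * δ / (N * ((N + 1 + k : ℕ) : ℝ) ^ 4)) := by
    intro k j n hn
    have hn2 := (Finset.mem_Icc.1 hn).1
    refine (measure_config_le hmeas hlaw hindep (measurableOnLists_deviates _ _ _ _)
      (fun s hs => hs.1) v δ k).trans ?_
    refine (measure_deviates_le (fun r => hmeas r j) (hindep.precomp (g := fun r => (r, j))
      fun a b h => congrArg Prod.fst h) (fun r => hlaw r j) (hsupp j) hn2
      (radius_nonneg N δ _ n)).trans (le_of_eq ?_)
    rw [exp_radius (by omega) hδ0 hδ1 (by omega) (by omega)]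
    congr 1
    field_simp
    norm_num
  have hk : ∀ k, P (⋃ j ∈ (Finset.univ : Finset (Fin N)), ⋃ n ∈ Finset.Icc 2 (k + 2), B k j n) ≤
      ENNReal.ofReal (δ / (N + k : ℕ) - δ / (N + (k + 1) : ℕ)) := by
    intro k
    have hN0 : (2 : ℝ) ≤ N := by exact_mod_cast hN
    have hk0 : (0 : ℝ) ≤ k := Nat.cast_nonneg k
    calc P (⋃ j ∈ (Finset.univ : Finset (Fin N)), ⋃ n ∈ Finset.Icc 2 (k + 2), B k j n)
        ≤ ∑ _j : Fin N, ∑ _n ∈ Finset.Icc 2 (k + 2),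
          ENNReal.ofReal (2 * δ / (N * ((N + 1 + k : ℕ) : ℝ) ^ 4)) :=
          (measure_biUnion_finset_le _ _).trans (Finset.sum_le_sum fun j _ =>
            (measure_biUnion_finset_le _ _).trans (Finset.sum_le_sum fun n hn => hbound k j n hn))
      _ = ENNReal.ofReal (N * ((k + 1) * (2 * δ / (N * ((N + 1 + k : ℕ) : ℝ) ^ 4)))) := by
          rw [Finset.sum_const, Finset.sum_const, Nat.card_Icc, Finset.card_univ,
            Fintype.card_fin, nsmul_eq_mul, nsmul_eq_mul, ENNReal.ofReal_mul (by positivity),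
            ENNReal.ofReal_mul (by positivity), ENNReal.ofReal_natCast,
            show k + 2 + 1 - 2 = k + 1 by omega, ← Nat.cast_succ k, ENNReal.ofReal_natCast]
      _ ≤ _ := by
          refine ENNReal.ofReal_le_ofReal ?_
          push_cast
          set T : ℝ := N + k with hT
          have hT2 : 2 ≤ T := by linarith
          have e : (N : ℝ) * ((k + 1) * (2 * δ / (N * (N + 1 + k) ^ 4))) =
              (k + 1) * (2 * δ) / (T + 1) ^ 4 := by
            rw [hT]
            field_simp
            ring
          have e2 : δ / T - δ / (N + (k + 1)) = δ / (T * (T + 1)) := by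
            rw [hT]
            field_simp
            ring
          rw [e, e2, div_le_div_iff₀ (by positivity) (by positivity)]
          have h1 : (k : ℝ) + 1 ≤ T + 1 := by linarith
          calc (k + 1) * (2 * δ) * (T * (T + 1)) ≤ (T + 1) * (2 * δ) * (T * (T + 1)) := by gcongr
            _ = δ * ((T + 1) ^ 2 * (2 * T)) := by ring
            _ ≤ δ * ((T + 1) ^ 2 * (T + 1) ^ 2) := by
              gcongr
              nlinarith
            _ = δ * (T + 1) ^ 4 := by ring
  refine (measure_mono hsub).trans ((measure_iUnion_le _).trans
    ((ENNReal.tsum_le_tsum hk).trans ?_))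
  refine ENNReal.tsum_le_of_sum_range_le fun K => ?_
  have hnn : ∀ k : ℕ, 0 ≤ δ / (N + k : ℕ) - δ / (N + (k + 1) : ℕ) := by
    intro k
    rw [sub_nonneg]
    refine div_le_div_of_nonneg_left hδ0.le ?_ ?_
    · exact_mod_cast (by omega : 0 < N + k)
    · exact_mod_cast (by omega : N + k ≤ N + (k + 1))
  rw [← ENNReal.ofReal_sum_of_nonneg fun k _ => hnn k,
    Finset.sum_range_sub' (fun k => δ / ((N + k : ℕ) : ℝ))]
  refine ENNReal.ofReal_le_ofReal ?_
  have h1 : δ / ((N + 0 : ℕ) : ℝ) ≤ δ := div_le_self hδ0.le (by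
    exact_mod_cast (by omega : 1 ≤ N + 0))
  have h2 : 0 ≤ δ / ((N + K : ℕ) : ℝ) := by positivity
  linarith

end

/-! ### Gaps -/

/-- The gap of an arm: the hardness is the sum of the inverse squares of the gaps. -/
def gap {N : ℕ} (ν : Fin N → Measure ℝ) (v : ℝ) (j : Fin N) : ℝ :=
  if hF : (feasible ν v).Nonempty then
    if j = bestArm ν v hF then bestGap ν v hF
    else if j ∈ suboptimal ν v then
      if j ∈ feasible ν v then meanGap ν v j / 2 else max (meanGap ν v j / 2) (varGap ν v j)
    else varGap ν v j
  else varGap ν v j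

/-- The best feasible arm is unique and strictly feasible. -/
def UniqueBest {N : ℕ} (ν : Fin N → Measure ℝ) (v : ℝ) : Prop :=
  ∀ hF : (feasible ν v).Nonempty, var ν (bestArm ν v hF) < v ∧
    ∀ j ∈ feasible ν v, j ≠ bestArm ν v hF → mean ν j < mean ν (bestArm ν v hF)

section Gaps

variable {N : ℕ} {ν : Fin N → Measure ℝ} {v : ℝ}

theorem mem_feasible {j : Fin N} : j ∈ feasible ν v ↔ var ν j ≤ v := by simp [feasible]

theorem mem_suboptimal (hF : (feasible ν v).Nonempty) {j : Fin N} :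
    j ∈ suboptimal ν v ↔ mean ν j < mean ν (bestArm ν v hF) := by simp [suboptimal, hF]

theorem bestArm_mem (hF : (feasible ν v).Nonempty) : bestArm ν v hF ∈ feasible ν v :=
  argmax_mem _ _ hF

theorem bestArm_notMem_suboptimal (hF : (feasible ν v).Nonempty) :
    bestArm ν v hF ∉ suboptimal ν v := by simp [mem_suboptimal hF]

theorem meanGap_eq (hF : (feasible ν v).Nonempty) (j : Fin N) :
    meanGap ν v j = mean ν (bestArm ν v hF) - mean ν j := by simp [meanGap, hF]

theorem gap_of_infeasible (hF : ¬ (feasible ν v).Nonempty) (j : Fin N) :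
    gap ν v j = varGap ν v j := by simp [gap, hF]

theorem gap_bestArm (hF : (feasible ν v).Nonempty) :
    gap ν v (bestArm ν v hF) = bestGap ν v hF := by simp [gap, hF]

theorem bestGap_le_varGap (hF : (feasible ν v).Nonempty) :
    bestGap ν v hF ≤ varGap ν v (bestArm ν v hF) := by
  unfold bestGap
  split_ifs
  · exact min_le_right _ _
  · exact le_rfl

theorem bestGap_le_meanGap (hF : (feasible ν v).Nonempty) {j : Fin N}
    (hj : j ∈ suboptimal ν v) : bestGap ν v hF ≤ meanGap ν v j / 2 := by
  have hS : (suboptimal ν v).Nonempty := ⟨j, hj⟩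
  have := le_argmax (mean ν) _ hS hj
  rw [bestGap, dif_pos hS]
  refine (min_le_left _ _).trans ?_
  rw [meanGap_eq hF, meanGap_eq hF]
  linarith

/-- The best arm and the three index sets partition the arms, because uniqueness makes every other
feasible arm suboptimal. In an infeasible instance all arms are infeasible and risky. -/
theorem hardness_eq_sum_gap (hbest : UniqueBest ν v) :
    hardness ν v = ∑ j, 1 / gap ν v j ^ 2 := by
  have hsum : ∀ (S : Finset (Fin N)) (f : Fin N → ℝ),
      ∑ i ∈ S, f i = ∑ i, if i ∈ S then f i else 0 := fun S f => by
    rw [Finset.sum_ite_mem, Finset.univ_inter]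
  unfold hardness
  by_cases hF : (feasible ν v).Nonempty
  · have h0 : 1 / bestGap ν v hF ^ 2 =
        ∑ i, if i = bestArm ν v hF then 1 / bestGap ν v hF ^ 2 else 0 := by simp
    rw [dif_pos hF, hsum (feasible ν v ∩ suboptimal ν v),
      hsum ((feasible ν v)ᶜ ∩ risky ν v), hsum ((feasible ν v)ᶜ ∩ suboptimal ν v), h0,
      ← Finset.sum_add_distrib, ← Finset.sum_add_distrib,
      ← Finset.sum_add_distrib]
    refine Finset.sum_congr rfl fun j _ => ?_
    by_cases hj : j = bestArm ν v hF
    · subst hj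
      simp [gap_bestArm, bestArm_mem, bestArm_notMem_suboptimal]
    · have hjF : j ∈ feasible ν v → j ∈ suboptimal ν v := fun h =>
        (mem_suboptimal hF).2 ((hbest hF).2 j h hj)
      by_cases h1 : j ∈ feasible ν v
      · have h2 := hjF h1
        simp [gap, hF, hj, h1, h2]
      · by_cases h2 : j ∈ suboptimal ν v <;> simp [gap, hF, hj, h1, h2, risky]
  · have hS : suboptimal ν v = ∅ := by simp [suboptimal, hF]
    have hF' := Finset.not_nonempty_iff_eq_empty.1 hF
    rw [dif_neg hF]
    simp [hS, hF', risky, gap_of_infeasible hF]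

theorem gap_pos (hbest : UniqueBest ν v) (j : Fin N) : 0 < gap ν v j := by
  have hvar : ∀ j, j ∉ feasible ν v → 0 < varGap ν v j := fun j hj =>
    abs_pos.2 (sub_ne_zero.2 fun h => hj (mem_feasible.2 h.le))
  by_cases hF : (feasible ν v).Nonempty
  · have hmean : ∀ j ∈ suboptimal ν v, 0 < meanGap ν v j / 2 := fun j hj => by
      rw [meanGap_eq hF]
      have := (mem_suboptimal hF).1 hj
      linarith
    by_cases hj : j = bestArm ν v hF
    · have hvb : 0 < varGap ν v (bestArm ν v hF) :=
        abs_pos.2 (sub_ne_zero.2 (hbest hF).1.ne)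
      rw [hj, gap_bestArm, bestGap]
      split_ifs with hS
      · exact lt_min (hmean _ (argmax_mem _ _ hS)) hvb
      · exact hvb
    · rw [gap, dif_pos hF, if_neg hj]
      split_ifs with hS hjF
      · exact hmean j hS
      · exact lt_max_of_lt_left (hmean j hS)
      · exact hvar j fun h => hS ((mem_suboptimal hF).2 ((hbest hF).2 j h hj))
  · rw [gap_of_infeasible hF]
    exact hvar j fun h => hF ⟨j, h⟩

/-- The threshold may exceed `1`, so the variance gap of the best arm alone proves nothing. With two
arms, either some arm is suboptimal and a mean gap bounds `bestGap`, or another arm is infeasible,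
which forces `v < 1`. -/
theorem gap_le_one (hN : 2 ≤ N) [∀ i, IsProbabilityMeasure (ν i)]
    (hsupp : ∀ i, ∀ᵐ y ∂(ν i), y ∈ Set.Icc (0 : ℝ) 1) (hv : 0 < v) (hbest : UniqueBest ν v)
    (j : Fin N) : gap ν v j ≤ 1 := by
  have hint : ∀ i, Integrable (fun y : ℝ => y) (ν i) := fun i =>
    Integrable.of_mem_Icc 0 1 (by fun_prop) (hsupp i)
  have hm0 : ∀ i, 0 ≤ mean ν i := fun i =>
    integral_nonneg_of_ae ((hsupp i).mono fun y hy => hy.1)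
  have hm1 : ∀ i, mean ν i ≤ 1 := fun i => by
    have := integral_mono_ae (hint i) (integrable_const (1 : ℝ))
      ((hsupp i).mono fun y hy => hy.2)
    simpa [mean] using this
  have hv1 : ∀ i, var ν i ≤ 1 := fun i => by
    have := variance_le_sq_of_bounded (X := id) (hsupp i) (by fun_prop)
    refine this.trans (by norm_num)
  have hv0 : ∀ i, 0 ≤ var ν i := fun i => variance_nonneg _ _
  have hvar : ∀ j, j ∉ feasible ν v → varGap ν v j ≤ 1 := fun j hj => by
    have h1 : v < var ν j := not_le.1 fun h => hj (mem_feasible.2 h)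
    rw [varGap, abs_of_pos (sub_pos.2 h1)]
    linarith [hv1 j]
  by_cases hF : (feasible ν v).Nonempty
  · have hmean : ∀ j, meanGap ν v j / 2 ≤ 1 := fun j => by
      rw [meanGap_eq hF]
      linarith [hm1 (bestArm ν v hF), hm0 j]
    by_cases hj : j = bestArm ν v hF
    · rw [hj, gap_bestArm]
      by_cases hS : (suboptimal ν v).Nonempty
      · exact (bestGap_le_meanGap hF hS.choose_spec).trans (hmean _)
      · have : Nontrivial (Fin N) := Fin.nontrivial_iff_two_le.2 hN
        obtain ⟨i, hi⟩ := exists_ne (bestArm ν v hF)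
        have hiF : i ∉ feasible ν v := fun h =>
          hS ⟨i, (mem_suboptimal hF).2 ((hbest hF).2 i h hi)⟩
        have h1 : v < var ν i := not_le.1 fun h => hiF (mem_feasible.2 h)
        refine (bestGap_le_varGap hF).trans ?_
        rw [varGap, abs_le]
        constructor <;> linarith [hv1 i, hv0 (bestArm ν v hF), hv1 (bestArm ν v hF)]
    · rw [gap, dif_pos hF, if_neg hj]
      split_ifs with hS hjF
      · exact hmean j
      · exact max_le (hmean j) (hvar j hjF)
      · exact hvar j fun h => hS ((mem_suboptimal hF).2 ((hbest hF).2 j h hj))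
  · rw [gap_of_infeasible hF]
    exact hvar j fun h => hF ⟨j, h⟩

theorem card_le_hardness (hN : 2 ≤ N) [∀ i, IsProbabilityMeasure (ν i)]
    (hsupp : ∀ i, ∀ᵐ y ∂(ν i), y ∈ Set.Icc (0 : ℝ) 1) (hv : 0 < v) (hbest : UniqueBest ν v) :
    (N : ℝ) ≤ hardness ν v := by
  rw [hardness_eq_sum_gap hbest]
  calc (N : ℝ) = ∑ _j : Fin N, (1 : ℝ) := by simp
    _ ≤ _ := Finset.sum_le_sum fun j _ => by
      have h0 := gap_pos hbest j
      rw [le_div_iff₀ (by positivity), one_mul]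
      exact pow_le_one₀ h0.le (gap_le_one hN hsupp hv hbest j)

end Gaps

/-! ### One time step with correct confidence intervals -/

section Step

variable {N : ℕ} {ν : Fin N → Measure ℝ} {v δ : ℝ} {t : ℕ} {A : Finset (Fin N)} {h : History N}

theorem mem_empFeasible {j : Fin N} :
    j ∈ empFeasible v δ t A h ↔ j ∈ A ∧ ucbVar δ t h j ≤ v := by simp [empFeasible]

theorem mem_possFeasible {j : Fin N} :
    j ∈ possFeasible v δ t A h ↔ j ∈ A ∧ lcbVar δ t h j ≤ v := by
  have h0 := radius_nonneg N δ t (pulls h j)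
  have h1 : ucbVar δ t h j ≤ v → lcbVar δ t h j ≤ v := fun h => by
    unfold ucbVar at h
    unfold lcbVar
    linarith
  simp only [possFeasible, empAlmostFeasible, Finset.mem_union, mem_empFeasible,
    Finset.mem_filter]
  constructor
  · rintro (h | h)
    · exact ⟨h.1, h1 h.2⟩
    · exact ⟨h.1, h.2.1⟩
  · rintro ⟨ha, hl⟩
    rcases le_or_gt (ucbVar δ t h j) v with hu | hu
    · exact Or.inl ⟨ha, hu⟩
    · exact Or.inr ⟨ha, hl, hu⟩

/-- The confidence intervals at time step `t` with history `h` are correct. -/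
def AccurateAt (ν : Fin N → Measure ℝ) (δ : ℝ) (t : ℕ) (h : History N) : Prop :=
  ∀ j, |sampleMean h j - mean ν j| ≤ radius N δ t (pulls h j) ∧
    |sampleVar h j - var ν j| ≤ radius N δ t (pulls h j)

variable (hacc : AccurateAt ν δ t h)
include hacc

theorem AccurateAt.lcbMean_le (j : Fin N) : lcbMean δ t h j ≤ mean ν j := by
  have := abs_le.1 (hacc j).1
  unfold lcbMean
  linarith

theorem AccurateAt.le_ucbMean (j : Fin N) : mean ν j ≤ ucbMean δ t h j := by
  have := abs_le.1 (hacc j).1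
  unfold ucbMean
  linarith

theorem AccurateAt.ucbMean_le (j : Fin N) :
    ucbMean δ t h j ≤ mean ν j + 2 * radius N δ t (pulls h j) := by
  have := abs_le.1 (hacc j).1
  unfold ucbMean
  linarith

theorem AccurateAt.le_lcbMean (j : Fin N) :
    mean ν j - 2 * radius N δ t (pulls h j) ≤ lcbMean δ t h j := by
  have := abs_le.1 (hacc j).1
  unfold lcbMean
  linarith

theorem AccurateAt.empFeasible_subset : empFeasible v δ t A h ⊆ feasible ν v := by
  intro j hj
  have h1 := (mem_empFeasible.1 hj).2
  have h2 := abs_le.1 (hacc j).2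
  unfold ucbVar at h1
  exact mem_feasible.2 (by linarith)

theorem AccurateAt.subset_possFeasible (hA : feasible ν v ⊆ A) :
    feasible ν v ⊆ possFeasible v δ t A h := by
  intro j hj
  have h1 := mem_feasible.1 hj
  have h2 := abs_le.1 (hacc j).2
  refine mem_possFeasible.2 ⟨hA hj, ?_⟩
  unfold lcbVar
  linarith

theorem AccurateAt.varGap_le_of_infeasible {j : Fin N} (hj : j ∈ possFeasible v δ t A h)
    (hjF : j ∉ feasible ν v) : varGap ν v j ≤ 2 * radius N δ t (pulls h j) := by
  have h1 := (mem_possFeasible.1 hj).2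
  have h2 := abs_le.1 (hacc j).2
  have h3 : v < var ν j := not_le.1 fun h => hjF (mem_feasible.2 h)
  unfold lcbVar at h1
  rw [varGap, abs_of_pos (sub_pos.2 h3)]
  linarith

theorem AccurateAt.varGap_le_of_feasible {j : Fin N} (hjA : j ∈ A) (hjF : j ∈ feasible ν v)
    (hj : j ∉ empFeasible v δ t A h) : varGap ν v j ≤ 2 * radius N δ t (pulls h j) := by
  have h1 : v < ucbVar δ t h j := not_le.1 fun h => hj (mem_empFeasible.2 ⟨hjA, h⟩)
  have h2 := abs_le.1 (hacc j).2
  have h3 := mem_feasible.1 hjF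
  unfold ucbVar at h1
  rw [varGap, abs_of_nonpos (sub_nonpos.2 h3)]
  linarith

/-- Being possibly feasible already bounds the variance gap of an infeasible arm; only the mean gap
remains to be supplied. -/
theorem AccurateAt.gap_le (hbest : UniqueBest ν v) (hF : (feasible ν v).Nonempty) {j : Fin N}
    (hjb : j ≠ bestArm ν v hF) (hj : j ∈ possFeasible v δ t A h)
    (hS : j ∈ suboptimal ν v → meanGap ν v j / 2 ≤ 2 * radius N δ t (pulls h j)) :
    gap ν v j ≤ 2 * radius N δ t (pulls h j) := by
  rw [gap, dif_pos hF, if_neg hjb]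
  split_ifs with h1 h2
  · exact hS h1
  · exact max_le (hS h1) (hacc.varGap_le_of_infeasible hj h2)
  · exact hacc.varGap_le_of_infeasible hj fun h =>
      h1 ((mem_suboptimal hF).2 ((hbest hF).2 j h hjb))

/-- If the leading arm is separated from all other possibly feasible arms, it has a small gap. -/
theorem AccurateAt.gap_le_of_separated (hbest : UniqueBest ν v) (hA : feasible ν v ⊆ A)
    (hP : (possFeasible v δ t A h ∩ potential v δ t A h).Nonempty) {i : Fin N}
    (hi : i ∈ possFeasible v δ t A h)
    (hsep : ∀ y ∈ possFeasible v δ t A h, y ≠ i → ucbMean δ t h y < lcbMean δ t h i) :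
    gap ν v i ≤ 2 * radius N δ t (pulls h i) := by
  by_cases hF : (feasible ν v).Nonempty
  · have hb := hacc.subset_possFeasible hA (bestArm_mem hF)
    by_cases hib : i = bestArm ν v hF
    · subst hib
      rw [gap_bestArm]
      -- It suffices that the best arm is not yet certified feasible. If it were, separation would
      -- make it the maximizer over `empFeasible` and leave no possibly feasible arm in `potential`,
      -- contradicting `hP`.
      refine (bestGap_le_varGap hF).trans
        (hacc.varGap_le_of_feasible (hA (bestArm_mem hF)) (bestArm_mem hF) fun hemp => ?_)
      have hne : (empFeasible v δ t A h).Nonempty := ⟨_, hemp⟩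
      have hx : argmax (sampleMean h) (empFeasible v δ t A h) hne = bestArm ν v hF := by
        by_contra hx
        have h1 := hsep _ (Finset.mem_union_left _ (argmax_mem (sampleMean h) _ hne)) hx
        have h2 := le_argmax (sampleMean h) _ hne hemp
        have h3 := radius_nonneg N δ t (pulls h (bestArm ν v hF))
        have h4 := radius_nonneg N δ t
          (pulls h (argmax (sampleMean h) (empFeasible v δ t A h) hne))
        unfold ucbMean lcbMean at h1
        linarith
      obtain ⟨y, hy⟩ := hP
      obtain ⟨hy1, hy2⟩ := Finset.mem_inter.1 hy
      rw [potential, dif_pos hne, Finset.mem_filter, hx] at hy2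
      exact absurd (hsep y hy1 hy2.2.2) (not_lt.2 hy2.2.1)
    · refine hacc.gap_le hbest hF hib hi fun hS => ?_
      have h1 := hsep _ hb (Ne.symm hib)
      have h2 := hacc.le_ucbMean (bestArm ν v hF)
      have h3 := hacc.lcbMean_le i
      have h4 := (mem_suboptimal hF).1 hS
      linarith
  · rw [gap_of_infeasible hF]
    exact hacc.varGap_le_of_infeasible hi fun h => hF ⟨_, h⟩

/-- If the leading arm and its competitor are not separated, one of them has a small gap. -/
theorem AccurateAt.gap_le_or_gap_le (hbest : UniqueBest ν v) (hA : feasible ν v ⊆ A)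
    {i c : Fin N} (hi : i ∈ possFeasible v δ t A h) (hc : c ∈ possFeasible v δ t A h)
    (hci : c ≠ i) (hmax : ∀ y ∈ possFeasible v δ t A h, sampleMean h y ≤ sampleMean h i)
    (hcmax : ∀ y ∈ possFeasible v δ t A h, y ≠ i → ucbMean δ t h y ≤ ucbMean δ t h c)
    (hic : lcbMean δ t h i ≤ ucbMean δ t h c) :
    gap ν v i ≤ 2 * radius N δ t (pulls h i) ∨ gap ν v c ≤ 2 * radius N δ t (pulls h c) := by
  by_cases hF : (feasible ν v).Nonempty
  · have hb := hacc.subset_possFeasible hA (bestArm_mem hF)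
    -- Let `Δ` be the mean gap and `r` denote radii. If `Δ / 2 > 2 r_j`, then `Δ ≤ 2 r_b + 2 r_j`
    -- leaves `Δ / 2 < 2 r_b`, and `bestGap ≤ Δ / 2`. Hence the halved mean gaps in the hardness.
    have hpair : ∀ j, j ∈ possFeasible v δ t A h → j ≠ bestArm ν v hF →
        mean ν (bestArm ν v hF) - mean ν j ≤
          2 * radius N δ t (pulls h (bestArm ν v hF)) + 2 * radius N δ t (pulls h j) →
        gap ν v (bestArm ν v hF) ≤ 2 * radius N δ t (pulls h (bestArm ν v hF)) ∨
          gap ν v j ≤ 2 * radius N δ t (pulls h j) := by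
      intro j hj hjb hle
      rw [or_iff_not_imp_right]
      intro hjg
      have hS : j ∈ suboptimal ν v ∧ ¬ meanGap ν v j / 2 ≤ 2 * radius N δ t (pulls h j) := by
        by_contra hcon
        exact hjg (hacc.gap_le hbest hF hjb hj fun hS => not_not.1 fun h => hcon ⟨hS, h⟩)
      have h1 := bestGap_le_meanGap hF hS.1
      have h2 := hS.2
      rw [gap_bestArm]
      rw [meanGap_eq hF] at h1 h2
      linarith
    by_cases hib : i = bestArm ν v hF
    · have h1 := hacc.ucbMean_le c
      have h2 := hacc.le_lcbMean i
      rw [hib] at hic h2 hci ⊢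
      exact hpair c hc hci (by linarith)
    by_cases hcb : c = bestArm ν v hF
    · rw [hcb, or_comm]
      refine hpair i hi hib ?_
      have h1 := hmax _ hb
      have h2 := abs_le.1 (hacc i).1
      have h3 := abs_le.1 (hacc (bestArm ν v hF)).1
      have h4 := radius_nonneg N δ t (pulls h i)
      have h5 := radius_nonneg N δ t (pulls h (bestArm ν v hF))
      linarith
    -- Neither arm is the best one, yet `c` has the larger upper bound: its `ucbMean` is at least
    -- the best mean, so its mean gap is at most twice its radius.
    · right
      refine hacc.gap_le hbest hF hcb hc fun _ => ?_
      have h1 := hcmax _ hb (Ne.symm hib)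
      have h2 := hacc.le_ucbMean (bestArm ν v hF)
      have h3 := hacc.ucbMean_le c
      have h4 := radius_nonneg N δ t (pulls h c)
      rw [meanGap_eq hF]
      linarith
  · left
    rw [gap_of_infeasible hF]
    exact hacc.varGap_le_of_infeasible hi fun h => hF ⟨_, h⟩

theorem AccurateAt.gap_le_of_pullOne (hbest : UniqueBest ν v) (hA : feasible ν v ⊆ A)
    {i : Fin N} (hact : action v δ t A h = Action.pullOne i) :
    gap ν v i ≤ 2 * radius N δ t (pulls h i) := by
  unfold action at hact
  split_ifs at hact with hP
  have hP' := Finset.nonempty_iff_ne_empty.2 hP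
  dsimp only at hact
  split_ifs at hact with hc hL
  · obtain rfl := Action.pullOne.inj hact
    refine hacc.gap_le_of_separated hbest hA hP' (argmax_mem _ _ _) fun y hy hyi => ?_
    exact (le_argmax (ucbMean δ t h) _ hc (Finset.mem_erase.2 ⟨hyi, hy⟩)).trans_lt (not_le.1 hL)
  · obtain rfl := Action.pullOne.inj hact
    refine hacc.gap_le_of_separated hbest hA hP' (argmax_mem _ _ _) fun y hy hyi => ?_
    exact absurd ⟨y, Finset.mem_erase.2 ⟨hyi, hy⟩⟩ hc

theorem AccurateAt.gap_le_of_pullTwo (hbest : UniqueBest ν v) (hA : feasible ν v ⊆ A)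
    {i c : Fin N} (hact : action v δ t A h = Action.pullTwo i c) :
    gap ν v i ≤ 2 * radius N δ t (pulls h i) ∨ gap ν v c ≤ 2 * radius N δ t (pulls h c) := by
  have hci := ne_of_action_eq_pullTwo hact
  unfold action at hact
  split_ifs at hact with hP
  dsimp only at hact
  split_ifs at hact with hc hL
  obtain ⟨rfl, rfl⟩ := Action.pullTwo.inj hact
  exact hacc.gap_le_or_gap_le hbest hA (argmax_mem _ _ _)
    (Finset.mem_of_mem_erase (argmax_mem _ _ hc)) hci (fun y hy => le_argmax _ _ _ hy)
    (fun y hy hyi => le_argmax (ucbMean δ t h) _ hc (Finset.mem_erase.2 ⟨hyi, hy⟩)) hL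

/-- At a halt no possibly feasible arm is in `potential`, but the best arm is possibly feasible and
its upper bound exceeds the lower bound of any empirically feasible arm. So it is the reference arm
itself. The maximizer over `possFeasible` would also lie in `potential` if it were a different arm.
-/
theorem AccurateAt.answer_eq (hA : feasible ν v ⊆ A) {answer : Option (Fin N)}
    (hact : action v δ t A h = Action.halt answer) : answer = correctAnswer ν v := by
  unfold action at hact
  by_cases hF : (feasible ν v).Nonempty
  · have hb := hacc.subset_possFeasible hA (bestArm_mem hF)
    rw [correctAnswer, dif_pos hF]
    split_ifs at hact with hP hE
    · obtain rfl := Action.halt.inj hact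
      have hpot : ∀ y ∈ possFeasible v δ t A h, y ∉ potential v δ t A h := fun y hy hy' =>
        Finset.notMem_empty y (hP ▸ Finset.mem_inter.2 ⟨hy, hy'⟩)
      have hx : argmax (sampleMean h) (empFeasible v δ t A h) hE = bestArm ν v hF := by
        by_contra hx
        refine hpot _ hb ?_
        rw [potential, dif_pos hE, Finset.mem_filter]
        refine ⟨Finset.mem_univ _, ?_, Ne.symm hx⟩
        exact (hacc.lcbMean_le _).trans ((le_argmax (mean ν) _ hF
          (hacc.empFeasible_subset (argmax_mem (sampleMean h) _ hE))).trans (hacc.le_ucbMean _))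
      congr 1
      by_contra hy
      have hmem := argmax_mem (sampleMean h) (possFeasible v δ t A h)
        (hE.mono Finset.subset_union_left)
      have hle := le_argmax (sampleMean h) (possFeasible v δ t A h)
        (hE.mono Finset.subset_union_left) hb
      refine hpot _ hmem ?_
      rw [potential, dif_pos hE, Finset.mem_filter, hx]
      refine ⟨Finset.mem_univ _, ?_, hy⟩
      have h3 := radius_nonneg N δ t (pulls h (bestArm ν v hF))
      have h4 := radius_nonneg N δ t (pulls h (argmax (sampleMean h) (possFeasible v δ t A h)
        (hE.mono Finset.subset_union_left)))
      unfold ucbMean lcbMean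
      linarith
    · refine absurd ?_ (Finset.notMem_empty (bestArm ν v hF))
      rw [← hP, potential, dif_neg hE]
      exact Finset.mem_inter.2 ⟨hb, Finset.mem_univ _⟩
    · dsimp only at hact
      split_ifs at hact
  · have hE : ¬ (empFeasible v δ t A h).Nonempty := fun hE => hF (hE.mono hacc.empFeasible_subset)
    rw [correctAnswer, dif_neg hF]
    split_ifs at hact with hP
    · exact (Action.halt.inj hact).symm
    · dsimp only at hact
      split_ifs at hact

end Step

/-! ### Termination -/

theorem mul_radius_sq {N : ℕ} {δ : ℝ} {t T : ℕ} (hT : 1 ≤ T)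
    (hL : 0 ≤ Real.log (2 * (N : ℝ) * (t : ℝ) ^ 4 / δ)) :
    T * radius N δ t T ^ 2 = Real.log (2 * (N : ℝ) * (t : ℝ) ^ 4 / δ) / 2 := by
  have hT' : (1 : ℝ) ≤ T := by exact_mod_cast hT
  rw [radius, Real.sq_sqrt (by positivity)]
  field_simp

theorem log_le_log_of_le {N : ℕ} (hN : 1 ≤ N) {δ : ℝ} (hδ0 : 0 < δ) {t M : ℕ} (ht : 1 ≤ t)
    (htM : t ≤ M) : Real.log (2 * (N : ℝ) * (t : ℝ) ^ 4 / δ) ≤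
      Real.log (2 * (N : ℝ) * (M : ℝ) ^ 4 / δ) := by
  have hN' : (1 : ℝ) ≤ N := by exact_mod_cast hN
  have ht' : (1 : ℝ) ≤ t := by exact_mod_cast ht
  have hM' : (t : ℝ) ≤ M := by exact_mod_cast htM
  refine Real.log_le_log (by positivity) ?_
  gcongr

theorem one_le_log {N : ℕ} (hN : 2 ≤ N) {δ : ℝ} (hδ0 : 0 < δ) (hδ1 : δ < 1) {t : ℕ}
    (ht : 1 ≤ t) : 1 ≤ Real.log (2 * (N : ℝ) * (t : ℝ) ^ 4 / δ) := by
  have hN' : (2 : ℝ) ≤ N := by exact_mod_cast hN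
  have ht' : (1 : ℝ) ≤ (t : ℝ) ^ 4 := one_le_pow₀ (by exact_mod_cast ht)
  have h4 : 4 ≤ 2 * (N : ℝ) * (t : ℝ) ^ 4 / δ := by
    rw [le_div_iff₀ hδ0]
    nlinarith
  rw [Real.le_log_iff_exp_le (by linarith)]
  linarith [Real.exp_one_lt_three]

/-- An upper bound on the solutions of the inequality that limits the running time. -/
theorem le_of_le_mul_log {n M H δ : ℝ} (hn : 2 ≤ n) (hnH : n ≤ H) (hM : 0 < M) (hδ0 : 0 < δ)
    (hδ1 : δ < 1) (hle : M ≤ 2 * H * Real.log (2 * n * M ^ 4 / δ)) :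
    M ≤ 152 * H * Real.log (H / δ) := by
  have hH : 0 < H := by linarith
  set z := M / H with hz
  have hz0 : 0 < z := div_pos hM hH
  have hMz : M = H * z := by rw [hz]; field_simp
  have hHY : H ≤ H / δ := by
    rw [le_div_iff₀ hδ0]
    nlinarith
  have h1 : Real.log (2 * n * M ^ 4 / δ) ≤
      Real.log 2 + Real.log (H / δ) + 4 * (Real.log (H / δ) + Real.log z) := by
    have e : Real.log 2 + Real.log (H / δ) + 4 * (Real.log (H / δ) + Real.log z) =
        Real.log (2 * (H / δ) * ((H / δ) * z) ^ 4) := by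
      rw [Real.log_mul (by positivity) (by positivity), Real.log_mul (by positivity)
        (by positivity), Real.log_pow, Real.log_mul (by positivity) (by positivity)]
      norm_num
    rw [e]
    refine Real.log_le_log (by positivity) ?_
    calc 2 * n * M ^ 4 / δ = 2 * (n / δ) * (H * z) ^ 4 := by rw [hMz]; ring
      _ ≤ 2 * (H / δ) * ((H / δ) * z) ^ 4 := by gcongr
  -- Tangent of the logarithm at `16`: multiplied by `2 * 4`, the term `z / 16` becomes `z / 2` and
  -- is absorbed on the left.
  have h2 : Real.log z ≤ z / 16 + 4 * Real.log 2 - 1 := by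
    have h3 := Real.log_le_sub_one_of_pos (show 0 < z / 16 by positivity)
    rw [Real.log_div hz0.ne' (by norm_num), show (16 : ℝ) = 2 ^ 4 by norm_num, Real.log_pow] at h3
    push_cast at h3
    norm_num at h3 ⊢
    linarith
  have h3 : z ≤ 2 * Real.log (2 * n * M ^ 4 / δ) := by
    rw [hz, div_le_iff₀ hH]
    linarith
  have h4 : Real.log 2 ≤ Real.log (H / δ) := Real.log_le_log (by norm_num) (by linarith)
  have h5 := Real.log_two_lt_d9
  have h6 := Real.log_two_gt_d9
  -- The estimates give `z ≤ 20 log (H / δ) + 68 log 2 - 16`, so the constant has slack; `152` is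
  -- half of `304`.
  have h7 : z ≤ 152 * Real.log (H / δ) := by linarith
  calc M = H * z := hMz
    _ ≤ H * (152 * Real.log (H / δ)) := by gcongr
    _ = _ := by ring

section Termination

variable {N : ℕ} {ν : Fin N → Measure ℝ} {v δ : ℝ} {x : ℕ → Fin N → ℝ}

theorem feasible_subset_of_running (hacc : Accurate ν v δ x) {k : ℕ} {A : Finset (Fin N)}
    {h : History N} (hk : config v δ x k = Config.running A h) : feasible ν v ⊆ A := by
  induction k generalizing A h with
  | zero =>
    simp only [config, Config.running.injEq] at hk
    rw [← hk.1]
    exact Finset.subset_univ _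
  | succ k ih =>
    obtain ⟨A', h', hk', rfl, -⟩ := exists_of_config_succ_eq_running hk
    exact AccurateAt.subset_possFeasible (hacc k A' h' hk') (ih hk')

/-- Every time step pulls an arm that has been pulled only a few times compared with its gap. -/
theorem exists_pulled_of_running (hN : 2 ≤ N) (hδ0 : 0 < δ) (hδ1 : δ < 1)
    (hbest : UniqueBest ν v) (hacc : Accurate ν v δ x) {k : ℕ} {A : Finset (Fin N)}
    {h : History N} (hk : config v δ x (k + 1) = Config.running A h) :
    ∃ A' h', config v δ x k = Config.running A' h' ∧ (∀ j, pulls h' j ≤ pulls h j) ∧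
      ∃ j, pulls h j = pulls h' j + 1 ∧ (pulls h' j : ℝ) ≤
        2 * Real.log (2 * (N : ℝ) * ((N + (k + 1) : ℕ) : ℝ) ^ 4 / δ) * (1 / gap ν v j ^ 2) := by
  obtain ⟨A', h', hk', -, hact⟩ := exists_of_config_succ_eq_running hk
  have hA := feasible_subset_of_running hacc hk'
  have hacc' : AccurateAt ν δ (N + 1 + k) h' := hacc k A' h' hk'
  have hsmall : ∀ j, gap ν v j ≤ 2 * radius N δ (N + 1 + k) (pulls h' j) →
      (pulls h' j : ℝ) ≤
        2 * Real.log (2 * (N : ℝ) * ((N + (k + 1) : ℕ) : ℝ) ^ 4 / δ) * (1 / gap ν v j ^ 2) := by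
    intro j hj
    have hg := gap_pos hbest j
    have h2 := (pulls_config hk' j).1
    have hL := one_le_log hN hδ0 hδ1 (t := N + 1 + k) (by omega)
    have hr := mul_radius_sq (N := N) (δ := δ) (t := N + 1 + k) (T := pulls h' j) (by omega)
      (by linarith)
    rw [show N + (k + 1) = N + 1 + k by omega, mul_one_div, le_div_iff₀ (by positivity)]
    -- With `T r² = L / 2`, the bound `gap ≤ 2 r` becomes `T gap² ≤ 2 L`.
    calc (pulls h' j : ℝ) * gap ν v j ^ 2
        ≤ pulls h' j * (2 * radius N δ (N + 1 + k) (pulls h' j)) ^ 2 := by gcongr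
      _ = 4 * (pulls h' j * radius N δ (N + 1 + k) (pulls h' j) ^ 2) := by ring
      _ = _ := by
        rw [hr]
        ring
  refine ⟨A', h', hk', ?_⟩
  rcases hact with ⟨i, hact, rfl⟩ | ⟨i, c, hact, rfl⟩
  · refine ⟨fun j => by rw [pulls_pull]; omega, i, by simp [pulls_pull], ?_⟩
    exact hsmall i (hacc'.gap_le_of_pullOne hbest hA hact)
  · have hci := ne_of_action_eq_pullTwo hact
    refine ⟨fun j => by rw [pulls_pull, pulls_pull]; omega, ?_⟩
    rcases hacc'.gap_le_of_pullTwo hbest hA hact with hi | hc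
    · exact ⟨i, by simp [pulls_pull, hci], hsmall i hi⟩
    · exact ⟨c, by simp [pulls_pull, hci.symm], hsmall c hc⟩

/-- A potential argument: the capped sum grows by at least one per time step. An arm with at most `B
= 2 Λ / gap ^ 2` pulls has at most `B + 1` after the step, two of them from the warm-up, hence the
cap `B - 1`. -/
theorem le_sum_min_of_running (hN : 2 ≤ N) (hδ0 : 0 < δ) (hδ1 : δ < 1)
    (hbest : UniqueBest ν v) (hacc : Accurate ν v δ x) {Λ : ℝ} {k : ℕ}
    (hΛ : ∀ t, 1 ≤ t → t ≤ N + k → Real.log (2 * (N : ℝ) * (t : ℝ) ^ 4 / δ) ≤ Λ)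
    (hΛ1 : ∀ j, 1 ≤ 2 * Λ * (1 / gap ν v j ^ 2)) {A : Finset (Fin N)} {h : History N}
    (hk : config v δ x k = Config.running A h) :
    (k : ℝ) ≤ ∑ j, min ((pulls h j : ℝ) - 2) (2 * Λ * (1 / gap ν v j ^ 2) - 1) := by
  induction k generalizing A h with
  | zero =>
    refine le_trans (by simp) (Finset.sum_nonneg fun j _ => le_min ?_ (by linarith [hΛ1 j]))
    have : (2 : ℝ) ≤ pulls h j := by exact_mod_cast (pulls_config hk j).1
    linarith
  | succ k ih =>
    obtain ⟨A', h', hk', hmono, j, hj, hsmall⟩ :=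
      exists_pulled_of_running hN hδ0 hδ1 hbest hacc hk
    have h1 := ih (fun t ht1 ht2 => hΛ t ht1 (by omega)) hk'
    have hle : ∀ i, min ((pulls h' i : ℝ) - 2) (2 * Λ * (1 / gap ν v i ^ 2) - 1) +
        (if i = j then 1 else 0) ≤
        min ((pulls h i : ℝ) - 2) (2 * Λ * (1 / gap ν v i ^ 2) - 1) := by
      intro i
      by_cases hij : i = j
      · subst hij
        have h2 : (pulls h' i : ℝ) ≤ 2 * Λ * (1 / gap ν v i ^ 2) := by
          refine hsmall.trans ?_
          have := hΛ (N + (k + 1)) (by omega) le_rfl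
          gcongr
        have h3 : (pulls h i : ℝ) = pulls h' i + 1 := by exact_mod_cast hj
        rw [if_pos rfl, h3]
        refine le_min ?_ ?_
        · linarith [min_le_left ((pulls h' i : ℝ) - 2) (2 * Λ * (1 / gap ν v i ^ 2) - 1)]
        · linarith [min_le_left ((pulls h' i : ℝ) - 2) (2 * Λ * (1 / gap ν v i ^ 2) - 1)]
      · have h3 : (pulls h' i : ℝ) ≤ pulls h i := by exact_mod_cast hmono i
        rw [if_neg hij, add_zero]
        exact min_le_min_right _ (by linarith)
    have h2 := Finset.sum_le_sum fun i (_ : i ∈ Finset.univ) => hle i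
    rw [Finset.sum_add_distrib, Finset.sum_ite_eq' Finset.univ j, if_pos (Finset.mem_univ j)] at h2
    push_cast
    linarith

theorem le_of_running (hN : 2 ≤ N) [∀ i, IsProbabilityMeasure (ν i)]
    (hsupp : ∀ i, ∀ᵐ y ∂(ν i), y ∈ Set.Icc (0 : ℝ) 1) (hv : 0 < v) (hδ0 : 0 < δ) (hδ1 : δ < 1)
    (hbest : UniqueBest ν v) (hacc : Accurate ν v δ x) {k : ℕ} {A : Finset (Fin N)}
    {h : History N} (hk : config v δ x k = Config.running A h) :
    ((N + k : ℕ) : ℝ) ≤ 152 * hardness ν v * Real.log (hardness ν v / δ) := by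
  have hN' : (2 : ℝ) ≤ N := by exact_mod_cast hN
  set Λ := Real.log (2 * (N : ℝ) * ((N + k : ℕ) : ℝ) ^ 4 / δ) with hΛdef
  have hΛ1 : 1 ≤ Λ := one_le_log hN hδ0 hδ1 (by omega)
  have hg1 : ∀ j, 1 ≤ 1 / gap ν v j ^ 2 := fun j => by
    have h0 := gap_pos hbest j
    rw [le_div_iff₀ (by positivity), one_mul]
    exact pow_le_one₀ h0.le (gap_le_one hN hsupp hv hbest j)
  have h1 := le_sum_min_of_running hN hδ0 hδ1 hbest hacc (Λ := Λ)
    (fun t ht1 ht2 => log_le_log_of_le (by omega) hδ0 ht1 ht2)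
    (fun j => by nlinarith [hg1 j]) hk
  -- The `-1` in each of the `N` caps pays for the `N` time steps of the warm-up.
  have h2 : (k : ℝ) ≤ 2 * Λ * hardness ν v - N := by
    refine h1.trans ((Finset.sum_le_sum fun j _ => min_le_right _ _).trans (le_of_eq ?_))
    rw [Finset.sum_sub_distrib, ← Finset.mul_sum, hardness_eq_sum_gap hbest]
    simp
  refine le_of_le_mul_log hN' (card_le_hardness hN hsupp hv hbest) ?_ hδ0 hδ1 ?_
  · exact_mod_cast (by omega : 0 < N + k)
  · rw [← hΛdef]
    push_cast
    linarith

theorem terminates_of_accurate (hN : 2 ≤ N) [∀ i, IsProbabilityMeasure (ν i)]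
    (hsupp : ∀ i, ∀ᵐ y ∂(ν i), y ∈ Set.Icc (0 : ℝ) 1) (hv : 0 < v) (hδ0 : 0 < δ) (hδ1 : δ < 1)
    (hbest : UniqueBest ν v) (hacc : Accurate ν v δ x) :
    ∃ (τ : ℕ) (h : History N) (answer : Option (Fin N)), TerminatesWith v δ x τ h answer ∧
      answer = correctAnswer ν v ∧
      (τ : ℝ) ≤ 304 * hardness ν v * Real.log (hardness ν v / δ) ∧
      (h.length : ℝ) ≤ 304 * hardness ν v * Real.log (hardness ν v / δ) := by
  have hhalt : ∃ k, ∀ A h, config v δ x k ≠ Config.running A h := by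
    by_contra! hcon
    obtain ⟨k, hk⟩ := exists_nat_gt (152 * hardness ν v * Real.log (hardness ν v / δ))
    obtain ⟨A, h, hA⟩ := hcon k
    have := le_of_running hN hsupp hv hδ0 hδ1 hbest hacc hA
    push_cast at this
    linarith [Nat.cast_nonneg (α := ℝ) N]
  classical
  -- `K` indexes the last running configuration. Both `N + 1 + K` and the number of rounds are at
  -- most `2 (N + K)`, which turns `152` into `304`.
  obtain ⟨K, hK⟩ : ∃ K, Nat.find hhalt = K + 1 := by
    refine Nat.exists_eq_succ_of_ne_zero fun h0 => ?_
    have := Nat.find_spec hhalt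
    rw [h0] at this
    exact this _ _ rfl
  have hK1 := Nat.find_spec hhalt
  have hK2 := Nat.find_min hhalt (m := K) (by omega)
  rw [hK] at hK1
  push Not at hK2
  obtain ⟨A, h, hA⟩ := hK2
  have hbound := le_of_running hN hsupp hv hδ0 hδ1 hbest hacc hA
  have hlen := length_config hA
  rcases hact : action v δ (N + 1 + K) A h with answer | i | ⟨i, c⟩
  · refine ⟨N + 1 + K, h, answer, ⟨K + 1, by simp [config, hA, step, hact]⟩,
      AccurateAt.answer_eq (hacc K A h hA) (feasible_subset_of_running hacc hA) hact, ?_, ?_⟩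
    · have : ((N + 1 + K : ℕ) : ℝ) ≤ 2 * ((N + K : ℕ) : ℝ) := by
        exact_mod_cast (by omega : N + 1 + K ≤ 2 * (N + K))
      linarith
    · have : (h.length : ℝ) ≤ 2 * ((N + K : ℕ) : ℝ) := by exact_mod_cast hlen
      linarith
  · exact absurd (by simp [config, hA, step, hact]) (hK1 (possFeasible v δ (N + 1 + K) A h)
      (pull x h i))
  · exact absurd (by simp [config, hA, step, hact]) (hK1 (possFeasible v δ (N + 1 + K) A h)
      (pull x (pull x h i) c))

end Termination

end VALUCB

end

/-! ### Conclusion: the probability of success -/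

theorem theorem1 {N : ℕ} (hN : 2 ≤ N)
    (ν : Fin N → Measure ℝ) [∀ i, IsProbabilityMeasure (ν i)]
    (hsupp : ∀ i, ∀ᵐ y ∂(ν i), y ∈ Set.Icc (0 : ℝ) 1)
    (v : ℝ) (hv : 0 < v)
    (hbest : ∀ hF : (VALUCB.feasible ν v).Nonempty,
      VALUCB.var ν (VALUCB.bestArm ν v hF) < v ∧
        ∀ j ∈ VALUCB.feasible ν v, j ≠ VALUCB.bestArm ν v hF →
          VALUCB.mean ν j < VALUCB.mean ν (VALUCB.bestArm ν v hF))
    (δ : ℝ) (hδ0 : 0 < δ) (hδ1 : δ < 1)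
    {Ω : Type*} [MeasurableSpace Ω] (P : Measure Ω) [IsProbabilityMeasure P]
    (X : ℕ → Fin N → Ω → ℝ)
    (hmeas : ∀ r i, Measurable (X r i))
    (hlaw : ∀ r i, P.map (X r i) = ν i)
    (hindep : iIndepFun (fun p : ℕ × Fin N => X p.1 p.2) P) :
    1 - δ ≤ P.real {ω | ∃ (τ : ℕ) (h : VALUCB.History N) (answer : Option (Fin N)),
      VALUCB.TerminatesWith v δ (fun r i => X r i ω) τ h answer ∧
        answer = VALUCB.correctAnswer ν v ∧
        (τ : ℝ) ≤ 304 * VALUCB.hardness ν v * Real.log (VALUCB.hardness ν v / δ) ∧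
        (h.length : ℝ) ≤ 304 * VALUCB.hardness ν v * Real.log (VALUCB.hardness ν v / δ)} := by
  have hbad : P.real {ω | ¬ VALUCB.Accurate ν v δ fun r i => X r i ω} ≤ δ :=
    ENNReal.toReal_le_of_le_ofReal hδ0.le
      (VALUCB.measure_not_accurate_le hN hsupp v hδ0 hδ1 hmeas hlaw hindep)
  -- Subadditivity replaces the complement formula, so `Accurate` need not be shown measurable.
  have hcover : P.real {ω | VALUCB.Accurate ν v δ fun r i => X r i ω} +
      P.real {ω | ¬ VALUCB.Accurate ν v δ fun r i => X r i ω} ≥ 1 := by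
    refine le_trans (le_of_eq ?_) (measureReal_union_le _ _)
    rw [← probReal_univ (μ := P)]
    congr 1
    ext ω
    simpa using em _
  have hge : 1 - δ ≤ P.real {ω | VALUCB.Accurate ν v δ fun r i => X r i ω} := by linarith
  exact hge.trans (measureReal_mono fun ω hω =>
    VALUCB.terminates_of_accurate hN hsupp hv hδ0 hδ1 hbest hω)
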